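/- Let $n,p\ge 1$ be integers and let $u_0$ be a holomorphic function in a neighbourhood of $0\in\mathbb{C}^n$. Consider, for complex variables $(t,x)=(t,x_1,\dots,x_n)\in\mathbb{C}\times\mathbb{C}^n$, the ramified Cauchy problem $$u_t-u\,(u_{x_1}+\dots+u_{x_n})=0,\qquad u(0,x)=u_0(x)+x_1^{1/p}.\qquad(*)$$ Then there exist an open neighbourhood $U$ of $0\in\mathbb{C}^{n+1}$ and holomorphic functions $v,a_0,\dots,a_{p-1}$ on $U$ with $$v(0,x)=u_0(x),\qquad a_0(0,x)=x_1,\qquad a_j(0,x)=0\quad(1\le j\le p-1)$$ for all $x$ with $(0,x)\in U$, such that $u=v+z$ is the unique solution of $(*)$, where the (multivalued) function $z$ is defined by $$z^p=a_{p-1}(t,x)\,z^{p-1}+\dots+a_1(t,x)\,z+a_0(t,x).\qquad(**)$$ Precisely, let $\Sigma\subset U$ be the set of points at which $(**)$ has a multiple root in $z$. Then: 1. $\Sigma$ is the zero set of a holomorphic function on $U$; a point $(0,x)\in U$ lies in $\Sigma$ if and only if $p\ge 2$ and $x_1=0$; and $\Sigma$ is characteristic for the equation, i.e. if $q\in\Sigma$,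 $\zeta$ is a multiple root of $(**)$ at $q$, and $h$ is a holomorphic germ at $q$ vanishing on $\Sigma$, then $h_t(q)=(v(q)+\zeta)\,(h_{x_1}(q)+\dots+h_{x_n}(q))$. 2. For every $q\in U\setminus\Sigma$ and every holomorphic germ $z$ at $q$ satisfying $(**)$, the germ $v+z$ satisfies $u_t=u\,(u_{x_1}+\dots+u_{x_n})$. 3. For every point $(0,x^0)\in U\setminus\Sigma$ and every holomorphic germ $r$ at $x^0$ with $r(x)^p=x_1$ (a branch of $x_1^{1/p}$), there is a holomorphic germ $z$ at $(0,x^0)$ satisfying $(**)$ and $z(0,x)=r(x)$ such that $u=v+z$ solves $(*)$ near $(0,x^0)$ with $x_1^{1/p}$ read as $r(x)$; every holomorphic germ at $(0,x^0)$ that solves this problem coincides with $u$; and $u$ can be continued holomorphically along every path in $U\setminus\Sigma$ starting at $(0,x^0)$. -/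

import Mathlib

open Filter Topology

namespace RamifiedBurgers

/-- The complex space-time `ℂ × ℂⁿ` with points `(t, x)`; the coordinate `x₁` is `x 0`. -/
abbrev SpaceTime (n : ℕ) : Type := ℂ × (Fin n → ℂ)

/-- The transport operator with speed `c` at the point `q`: `h_t - c (h_{x₁} + ⋯ + h_{xₙ})`. -/
noncomputable def transport {n : ℕ} (c : ℂ) (h : SpaceTime n → ℂ) (q : SpaceTime n) : ℂ :=
  fderiv ℂ h q (1, 0) - c * ∑ i : Fin n, fderiv ℂ h q (0, Pi.single i 1)

/-- The value at `q` of `u_t - u (u_{x₁} + ⋯ + u_{xₙ})`. -/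
noncomputable def burgers {n : ℕ} (u : SpaceTime n → ℂ) (q : SpaceTime n) : ℂ :=
  transport (u q) u q

/-- `r` is (a representative of) a holomorphic branch of `x₁ ^ (1/p)` at the point `x₀`. -/
def IsRootBranch {n : ℕ} [NeZero n] (p : ℕ) (r : (Fin n → ℂ) → ℂ) (x₀ : Fin n → ℂ) : Prop :=
  AnalyticAt ℂ r x₀ ∧ ∀ᶠ x in 𝓝 x₀, r x ^ p = x 0

/-- `u` is (a representative of) a holomorphic germ at `(0, x₀)` that solves
`u_t - u (u_{x₁} + ⋯ + u_{xₙ}) = 0`, `u(0, x) = u₀(x) + r(x)`. -/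
def IsSolutionGerm {n : ℕ} (u₀ r : (Fin n → ℂ) → ℂ) (x₀ : Fin n → ℂ)
    (u : SpaceTime n → ℂ) : Prop :=
  AnalyticAt ℂ u (0, x₀) ∧
    (∀ᶠ q in 𝓝 ((0, x₀) : SpaceTime n), burgers u q = 0) ∧
    ∀ᶠ x in 𝓝 x₀, u (0, x) = u₀ x + r x

/-- `ζ` is a root of the algebraic equation
`z ^ p = a_{p-1}(q) z ^ (p-1) + ⋯ + a_1(q) z + a_0(q)`. -/
def IsRootAt {n p : ℕ} (a : Fin p → SpaceTime n → ℂ) (q : SpaceTime n) (ζ : ℂ) : Prop :=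
  ζ ^ p = ∑ j : Fin p, a j q * ζ ^ (j : ℕ)

/-- `ζ` is a multiple root of the same equation: the `z`-derivative vanishes there as well. -/
def IsMultipleRootAt {n p : ℕ} (a : Fin p → SpaceTime n → ℂ) (q : SpaceTime n) (ζ : ℂ) : Prop :=
  IsRootAt a q ζ ∧
    (p : ℂ) * ζ ^ (p - 1) = ∑ j : Fin p, a j q * (((j : ℕ) : ℂ) * ζ ^ ((j : ℕ) - 1))

/-- `z` is (a representative of) a holomorphic germ at `q` that solves the algebraic equation. -/
def IsAlgebraicGerm {n p : ℕ} (a : Fin p → SpaceTime n → ℂ) (q : SpaceTime n)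
    (z : SpaceTime n → ℂ) : Prop :=
  AnalyticAt ℂ z q ∧ ∀ᶠ q' in 𝓝 q, IsRootAt a q' (z q')

/-- The germ of `f` at `γ 0` can be continued holomorphically along the path `γ`. -/
def ContinuesAlong {n : ℕ} (f : SpaceTime n → ℂ) (γ : C(unitInterval, SpaceTime n)) : Prop :=
  ∃ F : unitInterval → SpaceTime n → ℂ,
    F 0 =ᶠ[𝓝 (γ 0)] f ∧
    (∀ τ, AnalyticAt ℂ (F τ) (γ τ)) ∧
    ∀ τ, ∀ᶠ σ in 𝓝 τ, F σ =ᶠ[𝓝 (γ σ)] F τ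

/-- The set `S` is characteristic for the Burgers operator along `u = v + z`, where `z` is the
algebraic function with coefficients `a`: the symbol `τ - u (ξ₁ + ⋯ + ξₙ)` of the linearized
operator, with `u = v(q) + ζ` and `ζ` a value of `z` that branches at `q ∈ S`, vanishes on every
conormal `dh(q)`, `h` a holomorphic germ at `q` that vanishes on `S`. -/
def IsCharacteristic {n p : ℕ} (v : SpaceTime n → ℂ) (a : Fin p → SpaceTime n → ℂ)
    (S : Set (SpaceTime n)) : Prop :=
  ∀ q ∈ S, ∀ ζ : ℂ, IsMultipleRootAt a q ζ →
    ∀ h : SpaceTime n → ℂ, AnalyticAt ℂ h q → (∀ᶠ q' in 𝓝 q, q' ∈ S → h q' = 0) →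
      transport (v q + ζ) h q = 0

end RamifiedBurgers

/-!
A solution `u` is constant along the characteristic lines, which have direction `(1, -u, …, -u)`, so
that its value `c` at `q = (t, x)` solves the implicit equation `(c - u₀ y) ^ p = y₁`, where
`y = x + t c (1, …, 1)` is the point at which the line through `q` meets `t = 0`. Conversely, every
simple holomorphic solution of the implicit equation solves the differential equation. At the origin
the equation has a zero of order `p` in `z = c - u₀ x`, and Weierstrass preparation turns it into a
monic polynomial equation of degree `p` in `z`. The preparation is an instance of the inverse
function theorem: the derivative of `(b, Q) ↦ (z ^ p - ∑ b_j z ^ j) Q` at `(0, G)`, with `G` a unit,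
is division by `z ^ p`, an isomorphism in the disc algebra.

Off its discriminant locus the polynomial equation defines a covering, and lifting paths to it
continues the solutions. The discriminant locus is the envelope of the characteristic lines that
issue from a line parallel to `(1, …, 1)`: the envelope is tangent to each of these lines, so a
function that vanishes on the locus is annihilated by the characteristic direction.
-/

namespace RamifiedBurgers

section WeierstrassPoly

open Polynomial

variable {R S : Type*} [CommRing R] [CommRing S] {p : ℕ}

/-- The monic polynomial `X ^ p - ∑ j, a j X ^ j`, whose roots are the solutions of the algebraic
equation with coefficients `a`. -/
noncomputable def weierstrassPoly (a : Fin p → R) : R[X] :=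
  X ^ p - ∑ j : Fin p, C (a j) * X ^ (j : ℕ)

theorem eval_weierstrassPoly (a : Fin p → R) (z : R) :
    (weierstrassPoly a).eval z = z ^ p - ∑ j : Fin p, a j * z ^ (j : ℕ) := by
  simp [weierstrassPoly, eval_finsetSum]

theorem map_weierstrassPoly (φ : R →+* S) (a : Fin p → R) :
    (weierstrassPoly a).map φ = weierstrassPoly (φ ∘ a) := by
  simp [weierstrassPoly, Polynomial.map_sum]

theorem eval_derivative_weierstrassPoly (a : Fin p → R) (z : R) :
    (derivative (weierstrassPoly a)).eval z =
      p * z ^ (p - 1) - ∑ j : Fin p, a j * ((j : ℕ) * z ^ ((j : ℕ) - 1)) := by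
  simp [weierstrassPoly, derivative_X_pow, eval_finsetSum]

theorem weierstrassPoly_zero : weierstrassPoly (0 : Fin p → R) = X ^ p := by
  simp [weierstrassPoly]

theorem weierstrassPoly_single_zero [NeZero p] (c : R) :
    weierstrassPoly (Pi.single 0 c : Fin p → R) = X ^ p - C c := by
  rw [weierstrassPoly, Fintype.sum_eq_single 0 fun j hj => by simp [Pi.single_eq_of_ne hj]]
  simp

theorem degree_sum_C_mul_X_pow_lt (a : Fin p → R) :
    (∑ j : Fin p, C (a j) * X ^ (j : ℕ)).degree < (p : WithBot ℕ) := by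
  refine (degree_sum_le _ _).trans_lt ((Finset.sup_lt_iff (WithBot.bot_lt_coe p)).2 fun j _ => ?_)
  exact (degree_C_mul_X_pow_le _ _).trans_lt (WithBot.coe_lt_coe.2 j.2)

theorem monic_weierstrassPoly (a : Fin p → R) : (weierstrassPoly a).Monic :=
  monic_X_pow_sub (degree_sum_C_mul_X_pow_lt a)

theorem natDegree_weierstrassPoly [Nontrivial R] (a : Fin p → R) :
    (weierstrassPoly a).natDegree = p := by
  refine natDegree_eq_of_degree_eq_some ?_
  rw [weierstrassPoly, degree_sub_eq_left_of_degree_lt, degree_X_pow]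
  simpa only [degree_X_pow] using degree_sum_C_mul_X_pow_lt a

theorem coeff_weierstrassPoly (a : Fin p → R) (j : Fin p) :
    (weierstrassPoly a).coeff j = -a j := by
  simp [weierstrassPoly, finsetSum_coeff, coeff_X_pow, j.2.ne, Fin.val_inj]

theorem weierstrassPoly_injective :
    Function.Injective (weierstrassPoly : (Fin p → R) → R[X]) := fun a b hab => by
  ext j
  simpa only [coeff_weierstrassPoly, neg_inj] using congrArg (fun P : R[X] => P.coeff j) hab

/-- The resultant of `weierstrassPoly a` with its derivative: its discriminant, up to sign. -/
noncomputable def weierstrassDisc (a : Fin p → R) : R :=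
  resultant (weierstrassPoly a) (derivative (weierstrassPoly a)) p (p - 1)

theorem map_weierstrassDisc (φ : R →+* S) (a : Fin p → R) :
    weierstrassDisc (φ ∘ a) = φ (weierstrassDisc a) := by
  rw [weierstrassDisc, ← map_weierstrassPoly, derivative_map, resultant_map_map, weierstrassDisc]

theorem weierstrassDisc_eq_zero_iff {K : Type*} [Field K] [CharZero K] [IsAlgClosed K]
    (a : Fin p → K) :
    weierstrassDisc a = 0 ↔ ∃ z, (weierstrassPoly a).eval z = 0 ∧
      (derivative (weierstrassPoly a)).eval z = 0 := by
  have h := resultant_eq_zero_iff (f := weierstrassPoly a) (g := derivative (weierstrassPoly a))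
  rw [natDegree_derivative, natDegree_weierstrassPoly] at h
  rw [weierstrassDisc, h, and_iff_right (Or.inl (monic_weierstrassPoly a).ne_zero),
    isCoprime_iff_aeval_ne_zero_of_isAlgClosed K K]
  push Not
  simp only [coe_aeval_eq_eval]

theorem weierstrassDisc_single_eq_zero_iff {K : Type*} [Field K] [CharZero K] [IsAlgClosed K]
    [NeZero p] (c : K) : weierstrassDisc (Pi.single 0 c : Fin p → K) = 0 ↔ p ≠ 1 ∧ c = 0 := by
  have hroots : weierstrassDisc (Pi.single 0 c : Fin p → K) = 0 ↔
      ∃ z : K, z ^ p = c ∧ z ^ (p - 1) = 0 := by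
    simp [weierstrassDisc_eq_zero_iff, weierstrassPoly_single_zero, derivative_X_pow, sub_eq_zero,
      NeZero.ne p]
  rw [hroots]
  constructor
  · rintro ⟨z, rfl, hz⟩
    have hp : p - 1 ≠ 0 := by
      rintro hp
      simp [hp] at hz
    exact ⟨by omega, by rw [pow_eq_zero_iff hp |>.1 hz, zero_pow (NeZero.ne p)]⟩
  · rintro ⟨hp, rfl⟩
    have := NeZero.ne p
    exact ⟨0, zero_pow this, zero_pow (by omega)⟩

variable {𝕜 : Type*} [NontriviallyNormedField 𝕜]

theorem analyticAt_weierstrassDisc [CompleteSpace 𝕜] (a : Fin p → 𝕜) :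
    AnalyticAt 𝕜 weierstrassDisc a := by
  -- The discriminant is a polynomial in the coefficients: specialize the generic one.
  have hgeneric : (weierstrassDisc : (Fin p → 𝕜) → 𝕜) =
      fun b => MvPolynomial.eval b (weierstrassDisc MvPolynomial.X) := by
    ext b
    rw [← map_weierstrassDisc]
    congr 1
    ext j
    simp
  rw [hgeneric]
  exact AnalyticOnNhd.eval_mvPolynomial _ a (Set.mem_univ a)

theorem norm_lt_of_eval_weierstrassPoly_eq_zero {K : Type*} [NormedField K] {a : Fin p → K} {z : K}
    (hz : (weierstrassPoly a).eval z = 0) : ‖z‖ < ‖a‖ + 1 := by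
  have hmonic := monic_weierstrassPoly a
  have hcoeff : (Finset.range p).sup (fun k => ‖(weierstrassPoly a).coeff k‖₊) ≤ ‖a‖₊ :=
    Finset.sup_le fun k hk => by
      rw [coeff_weierstrassPoly a ⟨k, Finset.mem_range.1 hk⟩, nnnorm_neg]
      exact nnnorm_le_pi_nnnorm a _
  have hbound : cauchyBound (weierstrassPoly a) ≤ ‖a‖₊ + 1 := by
    rw [cauchyBound, hmonic.leadingCoeff, nnnorm_one, div_one, natDegree_weierstrassPoly]
    gcongr
  exact NNReal.coe_lt_coe.2 ((IsRoot.norm_lt_cauchyBound hmonic.ne_zero hz).trans_le hbound)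

theorem analyticAt_eval_weierstrassPoly (w : (Fin p → 𝕜) × 𝕜) :
    AnalyticAt 𝕜 (fun w : (Fin p → 𝕜) × 𝕜 => (weierstrassPoly w.1).eval w.2) w := by
  simp only [eval_weierstrassPoly]
  refine (analyticAt_snd.pow p).sub (Finset.analyticAt_fun_sum _ fun j _ => ?_)
  exact (((ContinuousLinearMap.proj j).comp (ContinuousLinearMap.fst 𝕜 _ _)).analyticAt w).mul
    (analyticAt_snd.pow _)

end WeierstrassPoly

section RootConditions

variable {n p : ℕ} {A : SpaceTime n → Fin p → ℂ} {q : SpaceTime n} {ζ : ℂ} {z : SpaceTime n → ℂ}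

theorem isRootAt_iff :
    IsRootAt (fun j q => A q j) q ζ ↔ (weierstrassPoly (A q)).eval ζ = 0 := by
  rw [IsRootAt, eval_weierstrassPoly, sub_eq_zero]

theorem isMultipleRootAt_iff :
    IsMultipleRootAt (fun j q => A q j) q ζ ↔ (weierstrassPoly (A q)).eval ζ = 0 ∧
      (Polynomial.derivative (weierstrassPoly (A q))).eval ζ = 0 := by
  rw [IsMultipleRootAt, isRootAt_iff, eval_derivative_weierstrassPoly, sub_eq_zero]

theorem isAlgebraicGerm_iff :
    IsAlgebraicGerm (fun j q => A q j) q z ↔ AnalyticAt ℂ z q ∧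
      ∀ᶠ q' in 𝓝 q, (weierstrassPoly (A q')).eval (z q') = 0 := by
  simp only [IsAlgebraicGerm, isRootAt_iff]

theorem weierstrassDisc_eq_zero_iff_exists_isMultipleRootAt :
    weierstrassDisc (A q) = 0 ↔ ∃ ζ, IsMultipleRootAt (fun j q => A q j) q ζ := by
  simp only [weierstrassDisc_eq_zero_iff, isMultipleRootAt_iff]

end RootConditions

section ImplicitFunction

variable {𝕜 E : Type*} [RCLike 𝕜] [NormedAddCommGroup E] [NormedSpace 𝕜 E]
  {f : E × 𝕜 → 𝕜} {x : E} {y d : 𝕜}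

theorem hasDerivAt_comp_prodMk_left {f' : E × 𝕜 →L[𝕜] 𝕜} (hf : HasFDerivAt f f' (x, y)) :
    HasDerivAt (fun y' => f (x, y')) (f' (0, 1)) y :=
  hf.comp_hasDerivAt y ((hasDerivAt_const y x).prodMk (hasDerivAt_id y))

variable [CompleteSpace E]

theorem exists_analyticAt_implicitFunction (hf : AnalyticAt 𝕜 f (x, y)) (hfxy : f (x, y) = 0)
    (hderiv : HasDerivAt (fun y' => f (x, y')) d y) (hd : d ≠ 0) :
    ∃ g : E → 𝕜, AnalyticAt 𝕜 g x ∧ g x = y ∧ (∀ᶠ x' in 𝓝 x, f (x', g x') = 0) ∧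
      ∀ᶠ w in 𝓝 (x, y), f w = 0 → w.2 = g w.1 := by
  have hsmooth : ContDiffAt 𝕜 ⊤ f (x, y) := hf.contDiffAt
  have htop : (⊤ : WithTop ℕ∞) ≠ 0 := by simp
  have hinv : (fderiv 𝕜 f (x, y) ∘L .inr 𝕜 E 𝕜).IsInvertible := by
    refine ⟨ContinuousLinearEquiv.unitsEquivAut 𝕜 (Units.mk0 d hd), ?_⟩
    ext
    simpa using hderiv.unique
      (hasDerivAt_comp_prodMk_left hf.differentiableAt.hasFDerivAt)
  refine ⟨hsmooth.implicitFunction htop hinv,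
    (hsmooth.contDiffAt_implicitFunction htop hinv).analyticAt,
    hsmooth.implicitFunction_apply_self htop hinv, ?_, ?_⟩
  · simpa [hfxy] using hsmooth.eventually_apply_implicitFunction htop hinv
  · filter_upwards [hsmooth.eventually_apply_eq_iff_implicitFunction htop hinv] with w hw hfw
    exact (hw.1 (by rw [hfw, hfxy])).symm

theorem exists_openPartialHomeomorph_fst_prodMk (hf : AnalyticAt 𝕜 f (x, y))
    (hderiv : HasDerivAt (fun y' => f (x, y')) d y) (hd : d ≠ 0) :
    ∃ e : OpenPartialHomeomorph (E × 𝕜) (E × 𝕜), (x, y) ∈ e.source ∧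
      (fun w : E × 𝕜 => (w.1, f w)) = e := by
  set f' := fderiv 𝕜 f (x, y)
  let T : (E × 𝕜) ≃L[𝕜] E × 𝕜 :=
    ContinuousLinearEquiv.skewProd (ContinuousLinearEquiv.refl 𝕜 E)
      (ContinuousLinearEquiv.unitsEquivAut 𝕜 (Units.mk0 d hd)) (f' ∘L .inl 𝕜 E 𝕜)
  have hf' (w : E × 𝕜) : f' w = f' (w.1, 0) + w.2 * d := by
    rw [hderiv.unique (hasDerivAt_comp_prodMk_left hf.differentiableAt.hasFDerivAt),
      ← smul_eq_mul, ← map_smul, ← map_add]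
    simp
  have hT : HasStrictFDerivAt (fun w : E × 𝕜 => (w.1, f w)) (T : (E × 𝕜) →L[𝕜] E × 𝕜) (x, y) := by
    refine (hasStrictFDerivAt_fst.prodMk hf.hasStrictFDerivAt).congr_fderiv
      (ContinuousLinearMap.ext fun w => Prod.ext (by simp [T]) ?_)
    simpa [T, add_comm] using hf' w
  exact ⟨hT.toOpenPartialHomeomorph _, hT.mem_toOpenPartialHomeomorph_source,
    hT.toOpenPartialHomeomorph_coe.symm⟩

end ImplicitFunction

theorem eventuallyEq_of_eventually_unique {X Y : Type*} [TopologicalSpace X] [TopologicalSpace Y]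
    {P : X × Y → Prop} {f g : X → Y} {x : X} (hunique : ∀ᶠ w in 𝓝 (x, g x), P w → w.2 = f w.1)
    (hg : ContinuousAt g x) (hP : ∀ᶠ x' in 𝓝 x, P (x', g x')) : g =ᶠ[𝓝 x] f := by
  have hgraph : Tendsto (fun x' => (x', g x')) (𝓝 x) (𝓝 (x, g x)) := continuousAt_id.prodMk hg
  filter_upwards [hgraph.eventually hunique, hP] with x' h h'
  exact h h'

section Roots

open Polynomial

variable {p : ℕ}

theorem exists_analyticAt_root {E : Type*} [NormedAddCommGroup E] [NormedSpace ℂ E]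
    [CompleteSpace E] {A : E → Fin p → ℂ} {q : E} (hA : AnalyticAt ℂ A q) {ζ : ℂ}
    (hζ : (weierstrassPoly (A q)).eval ζ = 0)
    (hζ' : (derivative (weierstrassPoly (A q))).eval ζ ≠ 0) :
    ∃ z : E → ℂ, AnalyticAt ℂ z q ∧ z q = ζ ∧
      (∀ᶠ q' in 𝓝 q, (weierstrassPoly (A q')).eval (z q') = 0) ∧
      ∀ᶠ w in 𝓝 (q, ζ), (weierstrassPoly (A w.1)).eval w.2 = 0 → w.2 = z w.1 := by
  refine exists_analyticAt_implicitFunction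
    (f := fun w : E × ℂ => (weierstrassPoly (A w.1)).eval w.2) ?_ hζ
    ((weierstrassPoly (A q)).hasDerivAt ζ) hζ'
  exact AnalyticAt.fun_comp (g := fun w : (Fin p → ℂ) × ℂ => (weierstrassPoly w.1).eval w.2)
    (f := fun w : E × ℂ => (A w.1, w.2)) (analyticAt_eval_weierstrassPoly _)
    ((AnalyticAt.fun_comp (g := A) (f := Prod.fst) hA analyticAt_fst).prod analyticAt_snd)

/-- The family of all monic polynomials of degree `p`, as a map over the space of coefficients;
its fibre over `(a, 0)` is the set of roots of `weierstrassPoly a`. -/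
noncomputable def polyFamily (w : (Fin p → ℂ) × ℂ) : (Fin p → ℂ) × ℂ :=
  (w.1, (weierstrassPoly w.1).eval w.2)

theorem continuous_polyFamily : Continuous (polyFamily (p := p)) :=
  continuous_iff_continuousAt.2 fun w =>
    continuousAt_fst.prodMk (analyticAt_eval_weierstrassPoly w).continuousAt

theorem isClosedMap_polyFamily [NeZero p] : IsClosedMap (polyFamily (p := p)) := by
  refine IsProperMap.isClosedMap (isProperMap_iff_isCompact_preimage.2
    ⟨continuous_polyFamily, fun K hK => ?_⟩)
  refine Metric.isCompact_of_isClosed_isBounded (hK.isClosed.preimage continuous_polyFamily) ?_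
  obtain ⟨R, hR⟩ := hK.isBounded.exists_norm_le
  refine isBounded_iff_forall_norm_le.2 ⟨R + R + 1, fun w hw => ?_⟩
  have hcoeff : ‖w.1‖ ≤ R := (norm_fst_le (polyFamily w)).trans (hR _ hw)
  have hvalue : ‖(weierstrassPoly w.1).eval w.2‖ ≤ R :=
    (norm_snd_le (polyFamily w)).trans (hR _ hw)
  -- Subtracting the value from the constant coefficient makes `w.2` a root.
  have hroot : (weierstrassPoly
      (w.1 + Pi.single 0 ((weierstrassPoly w.1).eval w.2))).eval w.2 = 0 := by
    simp [eval_weierstrassPoly, add_mul, Finset.sum_add_distrib, Pi.single_apply]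
  have hadd := norm_add_le w.1 (Pi.single 0 ((weierstrassPoly w.1).eval w.2))
  rw [Pi.norm_single] at hadd
  refine max_le ?_ ?_
  · linarith [norm_nonneg w.1]
  · linarith [norm_lt_of_eval_weierstrassPoly_eq_zero hroot]

theorem eventually_norm_root_lt [NeZero p] {δ : ℝ} (hδ : 0 < δ) :
    ∀ᶠ a in 𝓝 (0 : Fin p → ℂ), ∀ z, (weierstrassPoly a).eval z = 0 → ‖z‖ < δ := by
  have hclosed : IsClosed {a : Fin p → ℂ | (a, 0) ∈ polyFamily '' {w | δ ≤ ‖w.2‖}} :=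
    (isClosedMap_polyFamily _ (isClosed_le continuous_const continuous_snd.norm)).preimage
      (continuous_id.prodMk continuous_const)
  have hzero : (0 : Fin p → ℂ) ∉ {a : Fin p → ℂ | (a, 0) ∈ polyFamily '' {w | δ ≤ ‖w.2‖}} := by
    rintro ⟨⟨a, z⟩, hz, haz⟩
    obtain ⟨rfl, hroot⟩ := Prod.mk.inj haz
    have hz0 : z = 0 := by simpa [weierstrassPoly_zero, NeZero.ne p] using hroot
    simp only [hz0, Set.mem_ofPred_eq, norm_zero] at hz
    exact hδ.not_ge hz
  filter_upwards [hclosed.isOpen_compl.mem_nhds hzero] with a ha z hz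
  exact not_le.1 fun hδz => ha ⟨(a, z), hδz, Prod.ext rfl hz⟩

theorem isCoveringMapOn_polyFamily [NeZero p] :
    IsCoveringMapOn (polyFamily (p := p)) {w | weierstrassDisc w.1 ≠ 0 ∧ w.2 = 0} := by
  refine isClosedMap_polyFamily.isCoveringMapOn_of_isLocalHomeomorphOn ?_ ?_
  · rintro ⟨a, _⟩ ⟨-, rfl⟩
    refine (((weierstrassPoly a).roots.toFinset.finite_toSet).image fun z => (a, z)).subset ?_
    rintro ⟨_, z⟩ haz
    obtain ⟨rfl, hz⟩ := Prod.mk.inj haz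
    exact ⟨z, by simpa [(monic_weierstrassPoly _).ne_zero] using hz, rfl⟩
  · rintro ⟨a, z⟩ ⟨hdisc, hz⟩
    exact exists_openPartialHomeomorph_fst_prodMk (analyticAt_eval_weierstrassPoly (a, z))
      ((weierstrassPoly a).hasDerivAt z)
      fun hz' => hdisc ((weierstrassDisc_eq_zero_iff a).2 ⟨z, hz, hz'⟩)

theorem exists_root_lift [NeZero p] (α : C(unitInterval, Fin p → ℂ))
    (hα : ∀ τ, weierstrassDisc (α τ) ≠ 0) {ζ₀ : ℂ} (hζ₀ : (weierstrassPoly (α 0)).eval ζ₀ = 0) :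
    ∃ ζ : C(unitInterval, ℂ), ζ 0 = ζ₀ ∧ ∀ τ, (weierstrassPoly (α τ)).eval (ζ τ) = 0 := by
  set S : Set ((Fin p → ℂ) × ℂ) := {w | weierstrassDisc w.1 ≠ 0 ∧ w.2 = 0}
  have hcover := (isCoveringMapOn_polyFamily (p := p)).isCoveringMap_restrictPreimage
  let γ : C(unitInterval, S) := ⟨fun τ => ⟨(α τ, 0), hα τ, rfl⟩, by fun_prop⟩
  have hstart : polyFamily (α 0, ζ₀) = (α 0, 0) := Prod.ext rfl hζ₀
  let start : polyFamily ⁻¹' S := ⟨(α 0, ζ₀), by rw [Set.mem_preimage, hstart]; exact ⟨hα 0, rfl⟩⟩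
  obtain ⟨Γ, hΓ, hΓ0⟩ := hcover.exists_path_lifts γ start (Subtype.ext hstart.symm)
  refine ⟨⟨fun τ => (Γ τ : (Fin p → ℂ) × ℂ).2, by fun_prop⟩, by simp [hΓ0, start], fun τ => ?_⟩
  have hΓτ : polyFamily (Γ τ : (Fin p → ℂ) × ℂ) = (α τ, 0) :=
    congrArg Subtype.val (congrFun hΓ τ)
  obtain ⟨hcoeff, hroot⟩ := Prod.mk.inj hΓτ
  rw [← hcoeff]
  exact hroot

theorem IsAlgebraicGerm.eventuallyEq {n : ℕ} {A : SpaceTime n → Fin p → ℂ}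
    {q : SpaceTime n} {f g : SpaceTime n → ℂ} (hf : IsAlgebraicGerm (fun j q => A q j) q f)
    (hA : AnalyticAt ℂ A q) (hdisc : weierstrassDisc (A q) ≠ 0)
    (hg : IsAlgebraicGerm (fun j q => A q j) q g) (hfg : f q = g q) : f =ᶠ[𝓝 q] g := by
  rw [isAlgebraicGerm_iff] at hf hg
  obtain ⟨hfan, hfroot⟩ := hf
  obtain ⟨hgan, hgroot⟩ := hg
  obtain ⟨z, -, -, -, hunique⟩ := exists_analyticAt_root hA hfroot.self_of_nhds
    fun h => hdisc ((weierstrassDisc_eq_zero_iff _).2 ⟨_, hfroot.self_of_nhds, h⟩)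
  exact (eventuallyEq_of_eventually_unique hunique hfan.continuousAt hfroot).trans
    (eventuallyEq_of_eventually_unique (hfg ▸ hunique) hgan.continuousAt hgroot).symm

theorem continuesAlong_add_root [NeZero p] {n : ℕ} {v : SpaceTime n → ℂ}
    {A : SpaceTime n → Fin p → ℂ} {γ : C(unitInterval, SpaceTime n)}
    (hv : ∀ τ, AnalyticAt ℂ v (γ τ)) (hA : ∀ τ, AnalyticAt ℂ A (γ τ))
    (hdisc : ∀ τ, weierstrassDisc (A (γ τ)) ≠ 0) {z : SpaceTime n → ℂ}
    (hz : IsAlgebraicGerm (fun j q => A q j) (γ 0) z) :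
    ContinuesAlong (fun q => v q + z q) γ := by
  have hγ (τ : unitInterval) : Tendsto γ (𝓝 τ) (𝓝 (γ τ)) := γ.continuous.continuousAt
  have hAγ : Continuous fun τ => A (γ τ) := continuous_iff_continuousAt.2 fun τ =>
    (hA τ).continuousAt.tendsto.comp (hγ τ)
  obtain ⟨hzan, hzroot⟩ := isAlgebraicGerm_iff.1 hz
  obtain ⟨ζ, hζ0, hζ⟩ := exists_root_lift ⟨fun τ => A (γ τ), hAγ⟩ hdisc hzroot.self_of_nhds
  have hζ' (τ) : (derivative (weierstrassPoly (A (γ τ)))).eval (ζ τ) ≠ 0 := fun h =>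
    hdisc τ ((weierstrassDisc_eq_zero_iff _).2 ⟨_, hζ τ, h⟩)
  choose f hf _ hroot hunique using fun τ => exists_analyticAt_root (hA τ) (hζ τ) (hζ' τ)
  have hgerm {τ} {g : SpaceTime n → ℂ} (hg : ContinuousAt g (γ τ)) (hgγ : g (γ τ) = ζ τ)
      (hgroot : ∀ᶠ q in 𝓝 (γ τ), (weierstrassPoly (A q)).eval (g q) = 0) :
      (fun q => v q + g q) =ᶠ[𝓝 (γ τ)] fun q => v q + f τ q :=
    EventuallyEq.rfl.add
      (eventuallyEq_of_eventually_unique (by rw [hgγ]; exact hunique τ) hg hgroot)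
  refine ⟨fun τ q => v q + f τ q, ?_, fun τ => (hv τ).add (hf τ), fun τ => ?_⟩
  · exact (hgerm hzan.continuousAt hζ0.symm hzroot).symm
  · have hgraph : Tendsto (fun σ => (γ σ, ζ σ)) (𝓝 τ) (𝓝 (γ τ, ζ τ)) :=
      (γ.continuous.prodMk ζ.continuous).continuousAt
    filter_upwards [hgraph.eventually (hunique τ), (hγ τ).eventually (hroot τ).eventually_nhds,
      (hγ τ).eventually (hf τ).eventually_analyticAt] with σ hfσ hrootσ han
    exact (hgerm han.continuousAt (hfσ (hζ σ)).symm hrootσ).symm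

end Roots

section DiscAlgebra

open Metric

/-- The disc algebra: the continuous functions on the closed unit disc that are holomorphic in the
open disc. Weierstrass preparation is an inverse function theorem in this Banach algebra. -/
noncomputable def discAlgebra : Subalgebra ℂ C(closedBall (0 : ℂ) 1, ℂ) where
  carrier := {F | ∃ f : ℂ → ℂ, DiffContOnCl ℂ f (ball 0 1) ∧ ∀ z, F z = f z}
  mul_mem' := by
    rintro _ _ ⟨f, hf, hFf⟩ ⟨g, hg, hGg⟩
    exact ⟨fun z => f z • g z, hf.smul hg, fun z => by simp [hFf, hGg]⟩
  add_mem' := by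
    rintro _ _ ⟨f, hf, hFf⟩ ⟨g, hg, hGg⟩
    exact ⟨f + g, hf.add hg, fun z => by simp [hFf, hGg]⟩
  algebraMap_mem' c := ⟨fun _ => c, diffContOnCl_const, fun _ => rfl⟩

namespace discAlgebra

theorem ext {F G : discAlgebra} (h : ∀ z, F.1 z = G.1 z) : F = G :=
  Subtype.ext (ContinuousMap.ext h)

theorem exists_eq_of_diffContOnCl {f : ℂ → ℂ} (hf : DiffContOnCl ℂ f (ball 0 1)) :
    ∃ F : discAlgebra, ∀ z, F.1 z = f z := by
  have hcont : ContinuousOn f (closedBall 0 1) := by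
    simpa only [closure_ball (0 : ℂ) one_ne_zero] using hf.continuousOn
  exact ⟨⟨⟨fun z => f z, hcont.domRestrict⟩, f, hf, fun _ => rfl⟩, fun _ => rfl⟩

theorem isClosed : IsClosed (discAlgebra : Set C(closedBall (0 : ℂ) 1, ℂ)) := by
  refine IsSeqClosed.isClosed fun F G hF hFG => ?_
  choose f hf hFf using hF
  set g := Function.extend Subtype.val G 0
  have hg (z : closedBall (0 : ℂ) 1) : G z = g z := (Subtype.val_injective.extend_apply _ _ z).symm
  have hunif : TendstoUniformlyOn f g atTop (closedBall 0 1) := by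
    rw [tendstoUniformlyOn_iff_tendstoUniformly_comp_coe]
    simpa only [Function.comp_def, ← hFf, ← hg] using
      ContinuousMap.tendsto_iff_tendstoUniformly.1 hFG
  refine ⟨g, ⟨?_, ?_⟩, hg⟩
  · exact (hunif.mono ball_subset_closedBall).tendstoLocallyUniformlyOn.differentiableOn
      (.of_forall fun k => (hf k).differentiableOn) isOpen_ball
  · rw [closure_ball _ one_ne_zero, continuousOn_iff_continuous_domRestrict]
    exact G.continuous.congr hg

instance : CompleteSpace discAlgebra := isClosed.completeSpace_coe

theorem isUnit_of_forall_ne_zero {G : discAlgebra} (hG : ∀ z, G.1 z ≠ 0) : IsUnit G := by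
  obtain ⟨g, hg, hGg⟩ := G.2
  have hg0 : ∀ z ∈ closure (ball (0 : ℂ) 1), g z ≠ 0 := by
    rw [closure_ball _ one_ne_zero]
    exact fun z hz => hGg ⟨z, hz⟩ ▸ hG ⟨z, hz⟩
  obtain ⟨H, hH⟩ := exists_eq_of_diffContOnCl (hg.inv hg0)
  refine IsUnit.of_mul_eq_one H (ext fun z => ?_)
  simpa [hH, ← hGg] using mul_inv_cancel₀ (hG z)

theorem ne_zero_of_isUnit {G : discAlgebra} (hG : IsUnit G) (z : closedBall (0 : ℂ) 1) :
    G.1 z ≠ 0 :=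
  (hG.map ((ContinuousMap.evalAlgHom ℂ ℂ z).comp discAlgebra.val)).ne_zero

/-- The coordinate function `z` of the disc. -/
noncomputable def coord : discAlgebra := ⟨⟨Subtype.val, continuous_subtype_val⟩, id,
  differentiable_id.diffContOnCl, fun _ => rfl⟩

theorem aeval_coord_apply (P : Polynomial ℂ) (z : closedBall (0 : ℂ) 1) :
    (Polynomial.aeval coord P).1 z = P.eval (z : ℂ) :=
  (Polynomial.aeval_algHom_apply ((ContinuousMap.evalAlgHom ℂ ℂ z).comp discAlgebra.val)
    coord P).symm.trans (congrFun (Polynomial.coe_aeval_eq_eval _) P)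

theorem eq_zero_of_coord_mul_eq_zero {F : discAlgebra} (hF : coord * F = 0) : F = 0 := by
  obtain ⟨f, hf, hFf⟩ := F.2
  have hoff {z : ℂ} (hz : z ∈ closedBall 0 1) (hz0 : z ≠ 0) : f z = 0 := by
    have h : z * F.1 ⟨z, hz⟩ = 0 := congrArg (fun G : discAlgebra => G.1 ⟨z, hz⟩) hF
    rw [← hFf ⟨z, hz⟩, (mul_eq_zero_iff_left hz0).1 h]
  have hcont : Tendsto f (𝓝[≠] 0) (𝓝 (f 0)) :=
    (hf.differentiableOn.differentiableAt
      (ball_mem_nhds 0 one_pos)).continuousAt.tendsto.mono_left nhdsWithin_le_nhds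
  have hzero : f 0 = 0 := tendsto_nhds_unique (hcont.congr' ?_) tendsto_const_nhds
  · refine ext fun z => (hFf z).trans ?_
    rcases eq_or_ne (z : ℂ) 0 with hz | hz
    exacts [(congrArg f hz).trans hzero, hoff z.2 hz]
  · filter_upwards [self_mem_nhdsWithin, mem_nhdsWithin_of_mem_nhds (closedBall_mem_nhds 0 one_pos)]
      with z hz0 hz using hoff hz hz0

theorem exists_eq_smul_one_add_coord_mul (F : discAlgebra) :
    ∃ (c : ℂ) (H : discAlgebra), F = c • (1 : discAlgebra) + coord * H := by
  obtain ⟨f, hf, hFf⟩ := F.2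
  have hnhds : ball (0 : ℂ) 1 ∈ 𝓝 0 := ball_mem_nhds 0 one_pos
  have hslope : DiffContOnCl ℂ (dslope f 0) (ball 0 1) :=
    ⟨(Complex.differentiableOn_dslope hnhds).2 hf.differentiableOn,
      (continuousOn_dslope (mem_of_superset hnhds subset_closure)).2
        ⟨hf.continuousOn, hf.differentiableOn.differentiableAt hnhds⟩⟩
  obtain ⟨H, hH⟩ := exists_eq_of_diffContOnCl hslope
  refine ⟨f 0, H, ext fun z => ?_⟩
  have h := sub_smul_dslope f 0 (z : ℂ)
  rw [sub_zero, smul_eq_mul] at h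
  simp [hFf, hH, coord, h]

theorem exists_eq_sum_add_coord_pow_mul (p : ℕ) (F : discAlgebra) :
    ∃ (b : Fin p → ℂ) (Q : discAlgebra), F = ∑ j, b j • coord ^ (j : ℕ) + coord ^ p * Q := by
  induction p with
  | zero => exact ⟨0, F, by simp⟩
  | succ p ih =>
    obtain ⟨b, Q, rfl⟩ := ih
    obtain ⟨c, H, rfl⟩ := exists_eq_smul_one_add_coord_mul Q
    refine ⟨Fin.snoc b c, H, ?_⟩
    simp only [Fin.sum_univ_castSucc, Fin.snoc_castSucc, Fin.snoc_last, Fin.val_castSucc,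
      Fin.val_last, mul_add, mul_smul_comm, mul_one, pow_succ, mul_assoc, add_assoc]

theorem eq_zero_of_sum_add_coord_pow_mul_eq_zero {p : ℕ} {b : Fin p → ℂ} {Q : discAlgebra}
    (h : ∑ j, b j • coord ^ (j : ℕ) + coord ^ p * Q = 0) : b = 0 ∧ Q = 0 := by
  induction p generalizing Q with
  | zero => exact ⟨Subsingleton.elim _ _, by simpa using h⟩
  | succ p ih =>
    have hsplit : ∑ j : Fin p, b j.castSucc • coord ^ (j : ℕ) +
        coord ^ p * (b (Fin.last p) • 1 + coord * Q) = 0 := by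
      simpa only [Fin.sum_univ_castSucc, Fin.val_castSucc, Fin.val_last, mul_add, mul_smul_comm,
        mul_one, pow_succ, mul_assoc, add_assoc] using h
    obtain ⟨hinit, hrest⟩ := ih (b := fun j => b j.castSucc) hsplit
    have hlast : b (Fin.last p) = 0 := by
      simpa [coord] using
        congrArg (fun G : discAlgebra => G.1 ⟨0, mem_closedBall_self zero_le_one⟩) hrest
    refine ⟨funext (Fin.lastCases hlast (congrFun hinit)), eq_zero_of_coord_mul_eq_zero ?_⟩
    simpa only [hlast, zero_smul, zero_add] using hrest

end discAlgebra

end DiscAlgebra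

namespace discAlgebra

open Metric

variable {E F : Type*} [NormedAddCommGroup E] [NormedSpace ℂ E]
  [NormedAddCommGroup F] [NormedSpace ℂ F] {u : ℂ → E →L[ℂ] F}

/-- The multilinear map `m ↦ L (u z (m 0), …, u z (m (k - 1)))` with values in the functions of `z`,
for a holomorphic family `u` of linear contractions. -/
noncomputable def pullback {k : ℕ} (L : ContinuousMultilinearMap ℂ (fun _ : Fin k => F) ℂ)
    (hu : Differentiable ℂ u) (hu1 : ∀ z ∈ closedBall (0 : ℂ) 1, ‖u z‖ ≤ 1) :
    ContinuousMultilinearMap ℂ (fun _ : Fin k => E) discAlgebra :=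
  MultilinearMap.mkContinuous
    { toFun m :=
        have hdiff : Differentiable ℂ fun z => L.compContinuousLinearMap (fun _ => u z) m :=
          (L.contDiff (n := 1)).differentiable one_ne_zero |>.comp
            (differentiable_pi.2 fun _ => hu.clm_apply (differentiable_const _))
        ⟨⟨fun z => L.compContinuousLinearMap (fun _ => u z) m,
          hdiff.continuous.comp continuous_subtype_val⟩, _, hdiff.diffContOnCl, fun _ => rfl⟩
      map_update_add' m i x y :=
        ext fun z => (L.compContinuousLinearMap fun _ => u z).map_update_add m i x y
      map_update_smul' m i c x :=
        ext fun z => (L.compContinuousLinearMap fun _ => u z).map_update_smul m i c x }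
    ‖L‖ fun m => (ContinuousMap.norm_le _ (by positivity)).2 fun z =>
      L.le_opNorm_mul_prod_of_le fun i =>
        ((u z).le_of_opNorm_le (hu1 z z.2) (m i)).trans_eq (one_mul _)

theorem exists_analyticAt_pullback {h : F → ℂ} {s : FormalMultilinearSeries ℂ F ℂ} {y : F}
    {r : ENNReal} (hh : HasFPowerSeriesOnBall h s y r) (hu : Differentiable ℂ u)
    (hu1 : ∀ z ∈ closedBall (0 : ℂ) 1, ‖u z‖ ≤ 1) :
    ∃ c : E → discAlgebra, ∀ m ∈ eball 0 r, AnalyticAt ℂ c m ∧ ∀ z, (c m).1 z = h (y + u z m) := by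
  let T : FormalMultilinearSeries ℂ E discAlgebra := fun k => pullback (s k) hu hu1
  have hr : r ≤ T.radius := hh.r_le.trans <| FormalMultilinearSeries.radius_le_of_le fun _ =>
    MultilinearMap.mkContinuous_norm_le _ (norm_nonneg _) _
  have hT := T.hasFPowerSeriesOnBall (hh.r_pos.trans_le hr)
  refine ⟨T.sum, fun m hm => ⟨hT.analyticAt_of_mem (eball_subset_eball hr hm), fun z => ?_⟩⟩
  have hsum : HasSum (fun k => (T k fun _ => m).1 z) ((T.sum m).1 z) :=
    (T.hasSum (eball_subset_eball hr hm)).map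
      ((ContinuousMap.evalAlgHom ℂ ℂ z).comp discAlgebra.val)
      ((continuous_eval_const z).comp continuous_subtype_val)
  refine hsum.unique (hh.hasSum ?_)
  rw [mem_eball, edist_zero_right] at hm ⊢
  exact (enorm_le_iff_norm_le.2 <|
    ((u z).le_of_opNorm_le (hu1 z z.2) m).trans_eq (one_mul _)).trans_lt hm

theorem eventually_exists_analyticAt_curve {x₀ : E} {f : E × ℂ → ℂ}
    (hf : AnalyticAt ℂ f (x₀, 0)) :
    ∀ᶠ ρ in 𝓝 (0 : ℂ), ∃ c : E → discAlgebra, AnalyticAt ℂ c x₀ ∧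
      ∀ᶠ x in 𝓝 x₀, ∀ z, (c x).1 z = f (x, ρ * z) := by
  obtain ⟨s, r, hr⟩ := hf
  let u (z : ℂ) : E × ℂ →L[ℂ] E × ℂ := .inl ℂ E ℂ ∘L .fst ℂ E ℂ +
    z • (.inr ℂ E ℂ ∘L .snd ℂ E ℂ)
  have hu_apply (z : ℂ) (w : E × ℂ) : u z w = (w.1, z * w.2) := by simp [u]
  have hu : Differentiable ℂ u := by fun_prop
  have hu1 (z : ℂ) (hz : z ∈ closedBall (0 : ℂ) 1) : ‖u z‖ ≤ 1 := by
    refine ContinuousLinearMap.opNorm_le_bound _ zero_le_one fun w => ?_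
    rw [hu_apply, one_mul]
    refine max_le_max le_rfl ((norm_mul_le z w.2).trans ?_)
    exact mul_le_of_le_one_left (norm_nonneg _) (mem_closedBall_zero_iff.1 hz)
  obtain ⟨c, hc⟩ := exists_analyticAt_pullback hr hu hu1
  have hball : eball (0 : E × ℂ) r ∈ 𝓝 0 := eball_mem_nhds _ hr.r_pos
  have hρ : ∀ᶠ ρ : ℂ in 𝓝 0, ((0 : E), ρ) ∈ eball 0 r :=
    (by fun_prop : Continuous fun ρ : ℂ => ((0 : E), ρ)).continuousAt.eventually_mem hball
  filter_upwards [hρ] with ρ hρ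
  have hshift : AnalyticAt ℂ (fun x => (x - x₀, ρ)) x₀ := by fun_prop
  have hx₀ : (x₀ - x₀, ρ) ∈ eball 0 r := by rwa [sub_self]
  refine ⟨fun x => c (x - x₀, ρ), (hc _ hx₀).1.fun_comp (f := fun x => (x - x₀, ρ)) hshift, ?_⟩
  filter_upwards [hshift.continuousAt.eventually_mem (isOpen_eball.mem_nhds hx₀)] with x hx z
  rw [(hc _ hx).2, hu_apply]
  simp [mul_comm]

end discAlgebra

theorem exists_analyticAt_factorization {𝕜 V B : Type*} [RCLike 𝕜] [NormedAddCommGroup V]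
    [NormedSpace 𝕜 V] [CompleteSpace V] [NormedCommRing B] [NormedAlgebra 𝕜 B] [CompleteSpace B]
    {P : V →L[𝕜] B} {c G : B} (hG : IsUnit G) {T : (V × B) ≃L[𝕜] B}
    (hT : ∀ b Q, T (b, Q) = c * Q - G * P b) :
    ∃ β : B → V, AnalyticAt 𝕜 β (c * G) ∧ β (c * G) = 0 ∧
      ∀ᶠ F in 𝓝 (c * G), ∃ Q, IsUnit Q ∧ F = (c - P (β F)) * Q := by
  let Φ (w : V × B) : B := (c - P w.1) * w.2
  have hΦ : ContDiff 𝕜 ⊤ Φ := by fun_prop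
  have hΦ0 : Φ (0, G) = c * G := by simp [Φ]
  have htop : (⊤ : WithTop ℕ∞) ≠ 0 := by simp
  have hderiv : HasFDerivAt Φ (T : V × B →L[𝕜] B) (0, G) := by
    have hpoly : HasFDerivAt (fun w : V × B => c - P w.1) (-(P ∘L .fst 𝕜 V B)) (0, G) :=
      (P ∘L .fst 𝕜 V B).hasFDerivAt.const_sub c
    refine (hpoly.mul hasFDerivAt_snd).congr_fderiv (ContinuousLinearMap.ext fun w => ?_)
    simp [hT, sub_eq_add_neg]
  have hstrict := hΦ.contDiffAt.hasStrictFDerivAt' hderiv htop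
  set ψ := hΦ.contDiffAt.localInverse hderiv htop
  have hψan : AnalyticAt 𝕜 ψ (c * G) :=
    hΦ0 ▸ (hΦ.contDiffAt.to_localInverse hderiv htop).analyticAt
  have hψ0 : ψ (c * G) = (0, G) := hΦ0 ▸ hΦ.contDiffAt.localInverse_apply_image hderiv htop
  have hright : ∀ᶠ F in 𝓝 (c * G), Φ (ψ F) = F := hΦ0 ▸ hstrict.eventually_right_inverse
  have hunit : ∀ᶠ F in 𝓝 (c * G), IsUnit (ψ F).2 :=
    hψan.continuousAt.snd.eventually_mem (Units.isOpen.mem_nhds (by rwa [hψ0]))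
  refine ⟨fun F => (ψ F).1, analyticAt_fst.comp hψan, congrArg Prod.fst hψ0, ?_⟩
  filter_upwards [hright, hunit] with F hF hQ
  exact ⟨(ψ F).2, hQ, hF.symm⟩

namespace discAlgebra

variable {p : ℕ}

/-- The polynomial `∑ j, b j z ^ j` as an element of the disc algebra, linear in `b`. -/
noncomputable def polyPart (p : ℕ) : (Fin p → ℂ) →L[ℂ] discAlgebra :=
  ∑ j : Fin p, (ContinuousLinearMap.proj j).smulRight (coord ^ (j : ℕ))

theorem polyPart_apply (b : Fin p → ℂ) : polyPart p b = ∑ j, b j • coord ^ (j : ℕ) := by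
  simp [polyPart]

theorem aeval_coord_weierstrassPoly (b : Fin p → ℂ) :
    Polynomial.aeval coord (weierstrassPoly b) = coord ^ p - polyPart p b := by
  simp [weierstrassPoly, polyPart_apply, Algebra.smul_def]

theorem exists_continuousLinearEquiv_division {G : discAlgebra} (hG : IsUnit G) (p : ℕ) :
    ∃ T : ((Fin p → ℂ) × discAlgebra) ≃L[ℂ] discAlgebra,
      ∀ b Q, T (b, Q) = coord ^ p * Q - G * polyPart p b := by
  obtain ⟨G, rfl⟩ := hG
  let T : (Fin p → ℂ) × discAlgebra →L[ℂ] discAlgebra :=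
    (coord ^ p) • ContinuousLinearMap.snd ℂ _ _ -
      (G : discAlgebra) • (polyPart p ∘L ContinuousLinearMap.fst ℂ _ _)
  have hT (b Q) : T (b, Q) = coord ^ p * Q - G * polyPart p b := rfl
  refine ⟨ContinuousLinearEquiv.ofBijective T (LinearMap.ker_eq_bot'.2 ?_)
    (LinearMap.range_eq_top.2 fun F => ?_), fun b Q => hT b Q⟩
  · rintro ⟨b, Q⟩ (h : coord ^ p * Q - G * polyPart p b = 0)
    have hsum : ∑ j, (-b) j • coord ^ (j : ℕ) + coord ^ p * (↑G⁻¹ * Q) = 0 := by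
      rw [← polyPart_apply, map_neg]
      linear_combination (↑G⁻¹ : discAlgebra) * h + polyPart p b * G.inv_mul
    obtain ⟨hb, hQ⟩ := eq_zero_of_sum_add_coord_pow_mul_eq_zero hsum
    exact Prod.ext (neg_eq_zero.1 hb) (G⁻¹.isUnit.mul_right_eq_zero.1 hQ)
  · obtain ⟨b, Q, hF⟩ := exists_eq_sum_add_coord_pow_mul p (↑G⁻¹ * F)
    refine ⟨(-b, G * Q), (hT _ _).trans ?_⟩
    rw [← polyPart_apply] at hF
    rw [map_neg]
    linear_combination -(G : discAlgebra) * hF + F * G.mul_inv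

theorem exists_analyticAt_preparation {G : discAlgebra} (hG : IsUnit G) (p : ℕ) :
    ∃ b : discAlgebra → Fin p → ℂ, AnalyticAt ℂ b (coord ^ p * G) ∧ b (coord ^ p * G) = 0 ∧
      ∀ᶠ F in 𝓝 (coord ^ p * G), ∃ Q : discAlgebra, IsUnit Q ∧
        F = Polynomial.aeval coord (weierstrassPoly (b F)) * Q := by
  obtain ⟨T, hT⟩ := exists_continuousLinearEquiv_division hG p
  simpa only [aeval_coord_weierstrassPoly] using exists_analyticAt_factorization hG hT

end discAlgebra

section WeierstrassPreparation

open Polynomial Metric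

variable {p : ℕ}

theorem eval_weierstrassPoly_rescale {R : Type*} [CommRing R] (ρ : R) (b : Fin p → R) (w : R) :
    (weierstrassPoly fun j => ρ ^ (p - j) * b j).eval (ρ * w) =
      ρ ^ p * (weierstrassPoly b).eval w := by
  simp only [eval_weierstrassPoly, mul_sub, Finset.mul_sum, mul_pow]
  congr 1
  refine Finset.sum_congr rfl fun j _ => ?_
  rw [← pow_sub_mul_pow ρ j.2.le]
  ring

theorem exists_weierstrass_preparation_unit_disc {E : Type*} [NormedAddCommGroup E]
    [NormedSpace ℂ E] {x₀ : E} {c : E → discAlgebra} (hc : AnalyticAt ℂ c x₀) {G : discAlgebra}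
    (hG : IsUnit G) (hcG : c x₀ = discAlgebra.coord ^ p * G) :
    ∃ b : E → Fin p → ℂ, AnalyticAt ℂ b x₀ ∧ b x₀ = 0 ∧ ∀ᶠ x in 𝓝 x₀, ∃ Q : ℂ → ℂ,
      DifferentiableOn ℂ Q (ball 0 1) ∧ ∀ z : closedBall (0 : ℂ) 1, Q z ≠ 0 ∧
        (c x).1 z = (weierstrassPoly (b x)).eval (z : ℂ) * Q z := by
  obtain ⟨β, hβ, hβ0, hfactor⟩ := discAlgebra.exists_analyticAt_preparation hG p
  rw [← hcG] at hβ hβ0 hfactor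
  refine ⟨β ∘ c, hβ.comp hc, hβ0, ?_⟩
  filter_upwards [hc.continuousAt.eventually hfactor] with x hx
  obtain ⟨Q, hQ, hfac⟩ := hx
  obtain ⟨q, hq, hQq⟩ := Q.2
  refine ⟨q, hq.differentiableOn, fun z => ⟨hQq z ▸ discAlgebra.ne_zero_of_isUnit hQ z, ?_⟩⟩
  rw [← hQq z, Function.comp_apply, ← discAlgebra.aeval_coord_apply]
  exact congrArg (fun F : discAlgebra => F.1 z) hfac

theorem exists_eq_coord_pow_mul {f : ℂ → ℂ} (hf : AnalyticAt ℂ f 0)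
    (hord : analyticOrderAt f 0 = p) :
    ∀ᶠ ρ in 𝓝[≠] (0 : ℂ), ∃ G : discAlgebra, IsUnit G ∧
      ∀ z, (discAlgebra.coord ^ p * G).1 z = f (ρ * z) := by
  obtain ⟨g, hg, hg0, hfg⟩ := hf.analyticOrderAt_eq_natCast.1 hord
  obtain ⟨ε, hε, hball⟩ := Metric.eventually_nhds_iff_ball.1
    ((hg.eventually_analyticAt.and (hg.continuousAt.eventually_ne hg0)).and hfg)
  filter_upwards [self_mem_nhdsWithin, mem_nhdsWithin_of_mem_nhds (ball_mem_nhds 0 hε)]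
    with ρ hρ0 hρ
  have hmem {z : ℂ} (hz : z ∈ closedBall 0 1) : ρ * z ∈ ball 0 ε := by
    rw [mem_ball_zero_iff] at hρ ⊢
    refine ((norm_mul_le ρ z).trans ?_).trans_lt hρ
    exact mul_le_of_le_one_right (norm_nonneg _) (mem_closedBall_zero_iff.1 hz)
  have hdiff : DiffContOnCl ℂ (fun z => ρ ^ p * g (ρ * z)) (ball 0 1) := by
    refine DifferentiableOn.diffContOnCl fun z hz => ?_
    rw [closure_ball _ one_ne_zero] at hz
    have := (hball _ (hmem hz)).1.1.differentiableAt
    exact (by fun_prop : DifferentiableAt ℂ (fun z => ρ ^ p * g (ρ * z)) z).differentiableWithinAt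
  obtain ⟨G, hGg⟩ := discAlgebra.exists_eq_of_diffContOnCl hdiff
  refine ⟨G, discAlgebra.isUnit_of_forall_ne_zero fun z => ?_, fun z => ?_⟩
  · rw [hGg]
    exact mul_ne_zero (pow_ne_zero _ hρ0) (hball _ (hmem z.2)).1.2
  · have hcoord : (discAlgebra.coord ^ p * G).1 z = (z : ℂ) ^ p * G.1 z := rfl
    rw [hcoord, hGg, (hball _ (hmem z.2)).2, sub_zero, smul_eq_mul, mul_pow]
    ring

theorem exists_weierstrass_preparation {E : Type*} [NormedAddCommGroup E] [NormedSpace ℂ E]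
    {f : E × ℂ → ℂ} {x₀ : E} (hf : AnalyticAt ℂ f (x₀, 0))
    (hord : analyticOrderAt (fun z => f (x₀, z)) 0 = p) :
    ∃ a : E → Fin p → ℂ, AnalyticAt ℂ a x₀ ∧ a x₀ = 0 ∧ ∃ δ > 0, ∀ᶠ x in 𝓝 x₀,
      ∃ Q : ℂ → ℂ, DifferentiableOn ℂ Q (ball 0 δ) ∧ ∀ z ∈ ball 0 δ,
        Q z ≠ 0 ∧ f (x, z) = (weierstrassPoly (a x)).eval z * Q z := by
  have hfiber : AnalyticAt ℂ (fun z => f (x₀, z)) 0 :=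
    AnalyticAt.fun_comp (g := f) (f := fun z => (x₀, z)) hf (by fun_prop)
  obtain ⟨ρ, ⟨⟨c, hc, hcf⟩, G, hG, hGf⟩, hρ : ρ ≠ 0⟩ :=
    (((discAlgebra.eventually_exists_analyticAt_curve hf).filter_mono nhdsWithin_le_nhds).and
      (exists_eq_coord_pow_mul hfiber hord)).and self_mem_nhdsWithin |>.exists
  have hcG : c x₀ = discAlgebra.coord ^ p * G :=
    discAlgebra.ext fun z => (hcf.self_of_nhds z).trans (hGf z).symm
  obtain ⟨b, hb, hb0, hfactor⟩ := exists_weierstrass_preparation_unit_disc hc hG hcG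
  refine ⟨fun x j => ρ ^ (p - j) * b x j, ?_, funext fun j => by simp [hb0], ‖ρ‖,
    norm_pos_iff.2 hρ, ?_⟩
  · exact AnalyticAt.pi fun j => analyticAt_const.mul (analyticAt_pi_iff.1 hb j)
  filter_upwards [hcf, hfactor] with x hcx hx
  obtain ⟨Q, hQ, hfac⟩ := hx
  have hmem {z : ℂ} (hz : z ∈ ball 0 ‖ρ‖) : ρ⁻¹ * z ∈ ball 0 1 := by
    rw [mem_ball_zero_iff] at hz ⊢
    rwa [norm_mul, norm_inv, inv_mul_lt_one₀ (norm_pos_iff.2 hρ)]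
  refine ⟨fun z => (ρ ^ p)⁻¹ * Q (ρ⁻¹ * z), ?_, fun z hz => ?_⟩
  · exact (hQ.comp (by fun_prop) fun z hz => hmem hz).const_mul _
  · obtain ⟨hQ0, hval⟩ := hfac ⟨ρ⁻¹ * z, ball_subset_closedBall (hmem hz)⟩
    refine ⟨mul_ne_zero (inv_ne_zero (pow_ne_zero _ hρ)) hQ0, ?_⟩
    rw [hcx] at hval
    have hresc := eval_weierstrassPoly_rescale ρ (b x) (ρ⁻¹ * z)
    rw [mul_inv_cancel_left₀ hρ] at hresc hval
    rw [hval, hresc]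
    field_simp

end WeierstrassPreparation

section Uniqueness

open Polynomial

theorem prod_X_sub_C_dvd_of_eval_eq_mul {𝕜 : Type*} [NontriviallyNormedField 𝕜] {U : Set 𝕜}
    (hU : IsOpen U) {Q : 𝕜 → 𝕜} (hQ : ContinuousOn Q U) {s : Multiset 𝕜} (hs : ∀ α ∈ s, α ∈ U)
    {P : 𝕜[X]} (h : ∀ z ∈ U, P.eval z = (s.map fun α => X - C α).prod.eval z * Q z) :
    (s.map fun α => X - C α).prod ∣ P := by
  induction s using Multiset.induction generalizing P with
  | empty => simp
  | cons α s ih =>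
    simp only [Multiset.map_cons, Multiset.prod_cons, eval_mul, eval_sub, eval_X, eval_C] at h ⊢
    have hα : α ∈ U := hs α (Multiset.mem_cons_self α s)
    obtain ⟨P, rfl⟩ := dvd_iff_isRoot.2 (show P.eval α = 0 by simp [h α hα])
    refine mul_dvd_mul_left _ (ih (fun β hβ => hs β (Multiset.mem_cons_of_mem hβ)) ?_)
    set W := (s.map fun α => X - C α).prod
    have hoff {z : 𝕜} (hz : z ∈ U) (hzα : z ≠ α) : P.eval z = W.eval z * Q z := by
      refine mul_left_cancel₀ (sub_ne_zero.2 hzα) ?_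
      simpa [mul_assoc] using h z hz
    intro z hz
    rcases eq_or_ne z α with rfl | hzα
    · have hP : Tendsto P.eval (𝓝[≠] z) (𝓝 (P.eval z)) := P.continuous.continuousWithinAt
      have hWQ : Tendsto (fun y => W.eval y * Q y) (𝓝[≠] z) (𝓝 (W.eval z * Q z)) :=
        W.continuous.continuousWithinAt.mul
          (hQ.continuousAt (hU.mem_nhds hz)).continuousWithinAt
      refine tendsto_nhds_unique hP (hWQ.congr' ?_)
      filter_upwards [self_mem_nhdsWithin, mem_nhdsWithin_of_mem_nhds (hU.mem_nhds hz)]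
        with y hyz hy using (hoff hy hyz).symm
    · exact hoff hz hzα

theorem weierstrassPoly_unique {p : ℕ} {a b : Fin p → ℂ} {U : Set ℂ} (hU : IsOpen U) {Q : ℂ → ℂ}
    (hQ : ContinuousOn Q U) (ha : ∀ z, (weierstrassPoly a).eval z = 0 → z ∈ U)
    (h : ∀ z ∈ U, (weierstrassPoly b).eval z = (weierstrassPoly a).eval z * Q z) : a = b := by
  have hsplit := (IsAlgClosed.splits (weierstrassPoly a)).eq_prod_roots_of_monic
    (monic_weierstrassPoly a)
  have hdvd : weierstrassPoly a ∣ weierstrassPoly b := by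
    rw [hsplit] at h ⊢
    exact prod_X_sub_C_dvd_of_eval_eq_mul hU hQ (fun α hα => ha α (isRoot_of_mem_roots hα)) h
  refine weierstrassPoly_injective (eq_of_monic_of_dvd_of_natDegree_le (monic_weierstrassPoly a)
    (monic_weierstrassPoly b) hdvd ?_).symm
  rw [natDegree_weierstrassPoly, natDegree_weierstrassPoly]

end Uniqueness

section Characteristics

variable {n : ℕ}

/-- The direction `(1, -c, …, -c)` of the characteristic lines with speed `c`. -/
def charDir (n : ℕ) (c : ℂ) : SpaceTime n := (1, -(c • 1))

theorem charDir_eq (c : ℂ) : charDir n c = (1, 0) - c • (0, 1) := by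
  ext <;> simp [charDir]

theorem transport_eq_fderiv_charDir (c : ℂ) (h : SpaceTime n → ℂ) (q : SpaceTime n) :
    transport c h q = fderiv ℂ h q (charDir n c) := by
  have hsum : ∑ i : Fin n, ((0, Pi.single i 1) : SpaceTime n) = (0, 1) := by
    rw [← Finset.univ_sum_single (1 : Fin n → ℂ)]
    ext <;> simp [Prod.fst_sum, Prod.snd_sum]
  rw [transport, ← map_sum, hsum, charDir_eq, map_sub, map_smul, smul_eq_mul]

theorem continuousAt_transport {h : SpaceTime n → ℂ} {q : SpaceTime n} (hh : AnalyticAt ℂ h q)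
    (c : ℂ) : ContinuousAt (fun w : SpaceTime n × ℂ => transport w.2 h w.1) (q, c) := by
  have hfderiv (d : SpaceTime n) :
      ContinuousAt (fun w : SpaceTime n × ℂ => fderiv ℂ h w.1 d) (q, c) :=
    (hh.fderiv.continuousAt.comp_of_eq continuousAt_fst rfl).clm_apply continuousAt_const
  exact (hfderiv _).sub (continuousAt_snd.mul (tendsto_finsetSum _ fun i _ => hfderiv _))

theorem mul_transport_eq_zero_of_hasDerivAt {h : SpaceTime n → ℂ} {Q : ℂ → SpaceTime n}
    {t' c s : ℂ} (hh : DifferentiableAt ℂ h (Q s)) (hQ : HasDerivAt Q (t' • charDir n c) s)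
    (hzero : ∀ᶠ s' in 𝓝 s, h (Q s') = 0) : t' * transport c h (Q s) = 0 := by
  have hcomp := hh.hasFDerivAt.comp_hasDerivAt s hQ
  rw [map_smul, smul_eq_mul, ← transport_eq_fderiv_charDir] at hcomp
  exact hcomp.unique ((hasDerivAt_const s (0 : ℂ)).congr_of_eventuallyEq hzero)

/-- The point `x + t c (1, …, 1)` where the characteristic line with speed `c` through
`q = (t, x)` meets the initial hypersurface `t = 0`. -/
def foot (q : SpaceTime n) (c : ℂ) : Fin n → ℂ := q.2 + (q.1 * c) • 1

theorem foot_add_smul_charDir (q : SpaceTime n) (c s : ℂ) :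
    foot (q + s • charDir n c) c = foot q c := by
  ext i
  simp only [foot, charDir, Prod.snd_add, Prod.smul_snd, Prod.fst_add, Prod.smul_fst, Pi.add_apply,
    Pi.smul_apply, Pi.neg_apply, Pi.one_apply, smul_eq_mul]
  ring

theorem prodMk_zero_foot (q : SpaceTime n) (c : ℂ) :
    ((0, foot q c) : SpaceTime n) = q + -q.1 • charDir n c := by
  ext <;> simp [foot, charDir]

theorem foot_of_fst_eq_zero {q : SpaceTime n} (h : q.1 = 0) (c : ℂ) : foot q c = q.2 := by
  simp [foot, h]

theorem analyticAt_foot (w : SpaceTime n × ℂ) :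
    AnalyticAt ℂ (fun w : SpaceTime n × ℂ => foot w.1 w.2) w := by
  have hfst : AnalyticAt ℂ (fun w : SpaceTime n × ℂ => w.1.1) w :=
    AnalyticAt.fun_comp (g := Prod.fst) analyticAt_fst analyticAt_fst
  have hsnd : AnalyticAt ℂ (fun w : SpaceTime n × ℂ => w.1.2) w :=
    AnalyticAt.fun_comp (g := Prod.snd) analyticAt_snd analyticAt_fst
  exact hsnd.add ((hfst.mul analyticAt_snd).smul analyticAt_const)

theorem fderiv_charDir_of_burgers_eq_zero {w : SpaceTime n → ℂ} {q : SpaceTime n}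
    (hw : burgers w q = 0) (c : ℂ) :
    fderiv ℂ w q (charDir n c) = (w q - c) * fderiv ℂ w q (0, 1) := by
  rw [burgers, transport_eq_fderiv_charDir] at hw
  simp only [charDir_eq, map_sub, map_smul, smul_eq_mul] at hw ⊢
  linear_combination hw

theorem eq_of_burgers_eq_zero {w : SpaceTime n → ℂ} {V : Set (SpaceTime n)} (hV : Convex ℝ V)
    {K : ℝ} (hw : ∀ q ∈ V, DifferentiableAt ℂ w q) (hburgers : ∀ q ∈ V, burgers w q = 0)
    (hK : ∀ q ∈ V, ‖fderiv ℂ w q (0, 1)‖ ≤ K) {q : SpaceTime n} (hq : q ∈ V) {s : ℂ}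
    (hs : q + s • charDir n (w q) ∈ V) : w (q + s • charDir n (w q)) = w q := by
  set c := w q with hc
  let P : ℝ → SpaceTime n := AffineMap.lineMap q (q + s • charDir n c)
  have hPV {τ : ℝ} (hτ : τ ∈ Set.Icc 0 1) : P τ ∈ V := hV.lineMap_mem hq hs hτ
  have hP (τ : ℝ) : HasDerivAt P (s • charDir n c) τ := by
    simpa using AffineMap.hasDerivAt_lineMap (a := q) (b := q + s • charDir n c) (x := τ)
  -- `w - c` solves a linear differential equation along the segment, with zero initial value.
  have hderiv {τ : ℝ} (hτ : τ ∈ Set.Icc 0 1) : HasDerivAt (fun τ => w (P τ) - c)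
      (s * ((w (P τ) - c) * fderiv ℂ w (P τ) (0, 1))) τ := by
    refine ((((hw _ (hPV hτ)).hasFDerivAt.restrictScalars ℝ).comp_hasDerivAt τ
      (hP τ)).sub_const c).congr_deriv ?_
    rw [ContinuousLinearMap.coe_restrictScalars', map_smul, smul_eq_mul,
      fderiv_charDir_of_burgers_eq_zero (hburgers _ (hPV hτ))]
  have hzero := eq_zero_of_abs_deriv_le_mul_abs_self_of_eq_zero_right (K := ‖s‖ * K)
    (fun τ hτ => (hderiv hτ).continuousAt.continuousWithinAt)
    (fun τ hτ => (hderiv (Set.Ico_subset_Icc_self hτ)).hasDerivWithinAt)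
    (by simp [P, hc]) (fun τ hτ => ?_) 1 (Set.right_mem_Icc.2 zero_le_one)
  · simpa [P, sub_eq_zero] using hzero
  · rw [norm_mul, norm_mul, mul_comm ‖w (P τ) - c‖, ← mul_assoc]
    gcongr
    exact hK _ (hPV (Set.Ico_subset_Icc_self hτ))

theorem tendsto_foot {w : SpaceTime n → ℂ} {x₀ : Fin n → ℂ} (hw : ContinuousAt w (0, x₀)) :
    Tendsto (fun q => foot q (w q)) (𝓝 (0, x₀)) (𝓝 x₀) := by
  have hcont : ContinuousAt (fun q => foot q (w q)) (0, x₀) :=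
    ContinuousAt.comp (g := fun w : SpaceTime n × ℂ => foot w.1 w.2) (f := fun q => (q, w q))
      (analyticAt_foot _).continuousAt (continuousAt_id.prodMk hw)
  simpa only [foot_of_fst_eq_zero] using hcont.tendsto

theorem eventually_apply_foot_eq {w : SpaceTime n → ℂ} {x₀ : Fin n → ℂ}
    (hw : AnalyticAt ℂ w (0, x₀)) (hburgers : ∀ᶠ q in 𝓝 (0, x₀), burgers w q = 0) :
    ∀ᶠ q in 𝓝 (0, x₀), w (0, foot q (w q)) = w q := by
  have hbound : ∀ᶠ q in 𝓝 (0, x₀), ‖fderiv ℂ w q (0, 1)‖ < ‖fderiv ℂ w (0, x₀) (0, 1)‖ + 1 :=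
    (hw.fderiv.continuousAt.clm_apply continuousAt_const).norm.eventually_lt continuousAt_const
      (lt_add_one _)
  obtain ⟨ε, hε, hball⟩ := Metric.eventually_nhds_iff_ball.1
    ((hw.eventually_analyticAt.and hburgers).and hbound)
  have hfoot : Tendsto (fun q => ((0, foot q (w q)) : SpaceTime n)) (𝓝 (0, x₀)) (𝓝 (0, x₀)) :=
    tendsto_const_nhds.prodMk_nhds (tendsto_foot hw.continuousAt)
  filter_upwards [hfoot (Metric.ball_mem_nhds _ hε), Metric.ball_mem_nhds _ hε] with q hq' hq
  rw [Set.mem_preimage] at hq'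
  rw [prodMk_zero_foot] at hq' ⊢
  exact eq_of_burgers_eq_zero (convex_ball _ _) (fun q hq => (hball q hq).1.1.differentiableAt)
    (fun q hq => (hball q hq).1.2) (fun q hq => (hball q hq).2.le) hq hq'

theorem burgers_eq_zero_of_implicit {Φ : SpaceTime n × ℂ → ℂ} {u : SpaceTime n → ℂ}
    {q : SpaceTime n} (hu : DifferentiableAt ℂ u q) (hΦ : DifferentiableAt ℂ Φ (q, u q))
    (hline : ∀ s : ℂ, Φ (q + s • charDir n (u q), u q) = Φ (q, u q))
    (hzero : ∀ᶠ q' in 𝓝 q, Φ (q', u q') = 0) (hderiv : deriv (fun c => Φ (q, c)) (u q) ≠ 0) :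
    burgers u q = 0 := by
  set Φ' := fderiv ℂ Φ (q, u q)
  set d := fderiv ℂ u q (charDir n (u q))
  have hgraph : Φ' (charDir n (u q), d) = 0 := by
    have hcomp : HasFDerivAt (fun q' => Φ (q', u q')) (Φ' ∘L (.prod (.id ℂ _) (fderiv ℂ u q))) q :=
      hΦ.hasFDerivAt.comp q ((hasFDerivAt_id q).prodMk hu.hasFDerivAt)
    exact DFunLike.congr_fun (hcomp.unique ((hasFDerivAt_const 0 q).congr_of_eventuallyEq hzero)) _
  have hchar : Φ' (charDir n (u q), 0) = 0 := by
    have hconst : HasLineDerivAt ℂ Φ 0 (q, u q) (charDir n (u q), 0) := by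
      simpa [HasLineDerivAt, hline] using hasDerivAt_const (0 : ℂ) (Φ (q, u q))
    exact (hΦ.hasFDerivAt.hasLineDerivAt _).unique hconst
  rw [(hasDerivAt_comp_prodMk_left hΦ.hasFDerivAt).deriv] at hderiv
  have hsplit : (charDir n (u q), d) =
      (charDir n (u q), (0 : ℂ)) + d • ((0 : SpaceTime n), (1 : ℂ)) := by
    ext <;> simp
  rw [hsplit, map_add, map_smul, hchar, zero_add, smul_eq_mul] at hgraph
  rw [burgers, transport_eq_fderiv_charDir]
  exact (mul_eq_zero.1 hgraph).resolve_right hderiv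

end Characteristics

section ImplicitEquation

variable {n : ℕ} [NeZero n] {p : ℕ} {u₀ : (Fin n → ℂ) → ℂ}

/-- The value at `c` of `(c - u₀ y) ^ p - y₁`, where `y` is the foot of the characteristic line
with speed `c` through `q`: it vanishes when `c` is a value at `q` of the solution of the Cauchy
problem. -/
def implicitEq (p : ℕ) (u₀ : (Fin n → ℂ) → ℂ) (q : SpaceTime n) (c : ℂ) : ℂ :=
  (c - u₀ (foot q c)) ^ p - foot q c 0

theorem analyticAt_implicitEq {w : SpaceTime n × ℂ} (hu₀ : AnalyticAt ℂ u₀ (foot w.1 w.2)) :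
    AnalyticAt ℂ (fun w : SpaceTime n × ℂ => implicitEq p u₀ w.1 w.2) w := by
  have hcomp := AnalyticAt.fun_comp (g := u₀) (f := fun w : SpaceTime n × ℂ => foot w.1 w.2) hu₀
    (analyticAt_foot w)
  exact ((analyticAt_snd.sub hcomp).pow p).sub (analyticAt_pi_iff.1 (analyticAt_foot w) 0)

theorem hasDerivAt_implicitEq {q : SpaceTime n} {c : ℂ}
    (hu₀ : DifferentiableAt ℂ u₀ (foot q c)) :
    HasDerivAt (implicitEq p u₀ q)
      (p * (c - u₀ (foot q c)) ^ (p - 1) * (1 - q.1 * fderiv ℂ u₀ (foot q c) 1) - q.1) c := by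
  have hfoot : HasDerivAt (foot q) (q.1 • 1) c := by
    refine (((hasDerivAt_id c).const_mul q.1).smul_const (1 : Fin n → ℂ)).const_add q.2
      |>.congr_deriv ?_
    rw [mul_one]
  have hcomp : HasDerivAt (fun c => u₀ (foot q c)) (q.1 * fderiv ℂ u₀ (foot q c) 1) c :=
    (hu₀.hasFDerivAt.comp_hasDerivAt c hfoot).congr_deriv (by rw [map_smul, smul_eq_mul])
  have hfirst : HasDerivAt (fun c => foot q c 0) q.1 c := by simpa using hasDerivAt_pi.1 hfoot 0
  exact (((hasDerivAt_id c).sub hcomp).pow p).sub hfirst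

theorem burgers_eq_zero_of_implicitEq {u : SpaceTime n → ℂ} {q : SpaceTime n}
    (hu : DifferentiableAt ℂ u q) (hu₀ : AnalyticAt ℂ u₀ (foot q (u q)))
    (hzero : ∀ᶠ q' in 𝓝 q, implicitEq p u₀ q' (u q') = 0)
    (hderiv : deriv (implicitEq p u₀ q) (u q) ≠ 0) : burgers u q = 0 :=
  burgers_eq_zero_of_implicit (Φ := fun w => implicitEq p u₀ w.1 w.2) hu
    (analyticAt_implicitEq hu₀).differentiableAt
    (fun s => by simp only [implicitEq, foot_add_smul_charDir]) hzero hderiv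

theorem eventually_implicitEq_of_isSolutionGerm {r : (Fin n → ℂ) → ℂ} {x₀ : Fin n → ℂ}
    {w : SpaceTime n → ℂ} (hr : IsRootBranch p r x₀) (hw : IsSolutionGerm u₀ r x₀ w) :
    ∀ᶠ q in 𝓝 (0, x₀), implicitEq p u₀ q (w q) = 0 := by
  obtain ⟨hwan, hburgers, hinit⟩ := hw
  have hfoot := tendsto_foot hwan.continuousAt
  filter_upwards [eventually_apply_foot_eq hwan hburgers, hfoot.eventually hinit,
    hfoot.eventually hr.2] with q hconst hq hrq
  have hroot : w q - u₀ (foot q (w q)) = r (foot q (w q)) := by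
    rw [sub_eq_iff_eq_add', ← hq, hconst]
  rw [implicitEq, hroot, hrq, sub_self]

end ImplicitEquation

section Envelope

variable {n : ℕ} [NeZero n] {p : ℕ} {u₀ : (Fin n → ℂ) → ℂ} {y₀ : Fin n → ℂ} {w : ℂ}

/-- `c` is a multiple value at `q` of the solution of the implicit equation. -/
def IsDoubleZero (p : ℕ) (u₀ : (Fin n → ℂ) → ℂ) (q : SpaceTime n) (c : ℂ) : Prop :=
  implicitEq p u₀ q c = 0 ∧ deriv (implicitEq p u₀ q) c = 0

/-- The point of the line `y₀ + ℂ (1, …, 1)` at which `w` is a `p`-th root of the first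
coordinate. -/
def initialPoint (p : ℕ) (y₀ : Fin n → ℂ) (w : ℂ) : Fin n → ℂ :=
  y₀ + (w ^ p - y₀ 0) • 1

/-- The initial value at `initialPoint p y₀ w`, for the branch of the datum that takes the value
`w` there. -/
def initialValue (p : ℕ) (u₀ : (Fin n → ℂ) → ℂ) (y₀ : Fin n → ℂ) (w : ℂ) : ℂ :=
  u₀ (initialPoint p y₀ w) + w

/-- The time at which the characteristic line issuing from `initialPoint p y₀ w` touches the
envelope of the family of these lines. -/
noncomputable def envelopeTime (p : ℕ) (u₀ : (Fin n → ℂ) → ℂ) (y₀ : Fin n → ℂ) (w : ℂ) : ℂ :=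
  p * w ^ (p - 1) / deriv (initialValue p u₀ y₀) w

/-- The envelope of the characteristic lines issuing from `initialPoint p y₀ w`, `w ∈ ℂ`. -/
noncomputable def envelope (p : ℕ) (u₀ : (Fin n → ℂ) → ℂ) (y₀ : Fin n → ℂ) (w : ℂ) : SpaceTime n :=
  (envelopeTime p u₀ y₀ w,
    initialPoint p y₀ w - (envelopeTime p u₀ y₀ w * initialValue p u₀ y₀ w) • 1)

theorem initialPoint_apply_zero : initialPoint p y₀ w 0 = w ^ p := by
  simp [initialPoint]

theorem initialPoint_of_pow_eq (h : w ^ p = y₀ 0) : initialPoint p y₀ w = y₀ := by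
  simp [initialPoint, h]

theorem hasDerivAt_initialPoint (p : ℕ) (y₀ : Fin n → ℂ) (w : ℂ) :
    HasDerivAt (initialPoint p y₀) ((p * w ^ (p - 1)) • 1) w :=
  (((hasDerivAt_pow p w).sub_const (y₀ 0)).smul_const (1 : Fin n → ℂ)).const_add y₀

theorem analyticAt_initialValue (hu₀ : AnalyticAt ℂ u₀ (initialPoint p y₀ w)) :
    AnalyticAt ℂ (initialValue p u₀ y₀) w := by
  have hpoint : AnalyticAt ℂ (initialPoint p y₀) w :=
    analyticAt_const.add (((analyticAt_id.pow p).sub analyticAt_const).smul analyticAt_const)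
  exact (AnalyticAt.fun_comp (g := u₀) hu₀ hpoint).add analyticAt_id

theorem deriv_initialValue (hu₀ : DifferentiableAt ℂ u₀ (initialPoint p y₀ w)) :
    deriv (initialValue p u₀ y₀) w =
      p * w ^ (p - 1) * fderiv ℂ u₀ (initialPoint p y₀ w) 1 + 1 := by
  have h := (hu₀.hasFDerivAt.comp_hasDerivAt w (hasDerivAt_initialPoint p y₀ w)).add
    (hasDerivAt_id w)
  rw [map_smul, smul_eq_mul] at h
  exact h.deriv

theorem analyticAt_envelopeTime (hu₀ : AnalyticAt ℂ u₀ (initialPoint p y₀ w))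
    (hne : deriv (initialValue p u₀ y₀) w ≠ 0) : AnalyticAt ℂ (envelopeTime p u₀ y₀) w :=
  (analyticAt_const.mul (analyticAt_id.pow _)).div (analyticAt_initialValue hu₀).deriv hne

theorem foot_envelope :
    foot (envelope p u₀ y₀ w) (initialValue p u₀ y₀ w) = initialPoint p y₀ w := by
  simp [foot, envelope]

theorem hasDerivAt_envelope (hu₀ : AnalyticAt ℂ u₀ (initialPoint p y₀ w))
    (hne : deriv (initialValue p u₀ y₀) w ≠ 0) :
    HasDerivAt (envelope p u₀ y₀)
      (deriv (envelopeTime p u₀ y₀) w • charDir n (initialValue p u₀ y₀ w)) w := by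
  have htime := (analyticAt_envelopeTime hu₀ hne).differentiableAt.hasDerivAt
  have hvalue := (analyticAt_initialValue hu₀).differentiableAt.hasDerivAt
  have hcancel : envelopeTime p u₀ y₀ w * deriv (initialValue p u₀ y₀) w = p * w ^ (p - 1) :=
    div_mul_cancel₀ _ hne
  refine htime.prodMk ((hasDerivAt_initialPoint p y₀ w).sub ((htime.mul hvalue).smul_const 1))
    |>.congr_deriv ?_
  rw [hcancel, ← sub_smul, charDir, Prod.smul_mk, smul_neg, smul_smul, ← neg_smul, smul_eq_mul,
    mul_one]
  congr 2
  ring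

theorem isDoubleZero_envelope (hu₀ : DifferentiableAt ℂ u₀ (initialPoint p y₀ w))
    (hne : deriv (initialValue p u₀ y₀) w ≠ 0) :
    IsDoubleZero p u₀ (envelope p u₀ y₀ w) (initialValue p u₀ y₀ w) := by
  have hroot : initialValue p u₀ y₀ w - u₀ (initialPoint p y₀ w) = w := add_sub_cancel_left _ _
  have hcancel : (envelope p u₀ y₀ w).1 * deriv (initialValue p u₀ y₀) w = p * w ^ (p - 1) :=
    div_mul_cancel₀ _ hne
  constructor
  · rw [implicitEq, foot_envelope, hroot, initialPoint_apply_zero, sub_self]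
  · rw [(hasDerivAt_implicitEq (by rwa [foot_envelope])).deriv, foot_envelope, hroot]
    rw [deriv_initialValue hu₀] at hcancel
    linear_combination -hcancel

theorem IsDoubleZero.exists_eq_envelope {q : SpaceTime n} {c : ℂ} (h : IsDoubleZero p u₀ q c)
    (hu₀ : DifferentiableAt ℂ u₀ (foot q c)) :
    ∃ y₀ w, foot q c = initialPoint p y₀ w ∧ c = initialValue p u₀ y₀ w ∧
      q = envelope p u₀ y₀ w ∧ deriv (initialValue p u₀ y₀) w ≠ 0 := by
  set y₀ := foot q c with hy₀
  set w := c - u₀ y₀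
  have hpoint : initialPoint p y₀ w = y₀ := initialPoint_of_pow_eq (sub_eq_zero.1 h.1)
  have hvalue : initialValue p u₀ y₀ w = c := by rw [initialValue, hpoint, add_sub_cancel]
  have hderiv : deriv (initialValue p u₀ y₀) w = p * w ^ (p - 1) * fderiv ℂ u₀ y₀ 1 + 1 := by
    rw [deriv_initialValue (by rwa [hpoint]), hpoint]
  have htime : q.1 * deriv (initialValue p u₀ y₀) w = p * w ^ (p - 1) := by
    have hdouble := h.2
    rw [(hasDerivAt_implicitEq hu₀).deriv] at hdouble
    rw [hderiv]
    linear_combination -hdouble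
  have hne : deriv (initialValue p u₀ y₀) w ≠ 0 := by
    intro h0
    rw [h0, mul_zero] at htime
    rw [hderiv, ← htime, zero_mul, zero_add] at h0
    exact one_ne_zero h0
  refine ⟨y₀, w, hpoint.symm, hvalue.symm, ?_, hne⟩
  have htime' : envelopeTime p u₀ y₀ w = q.1 := (div_eq_iff hne).2 htime.symm
  rw [envelope, htime', hpoint, hvalue, hy₀, foot, add_sub_cancel_right]

theorem eventually_regular_initialValue (hu₀ : AnalyticAt ℂ u₀ (initialPoint p y₀ w))
    (hne : deriv (initialValue p u₀ y₀) w ≠ 0) :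
    ∀ᶠ w' in 𝓝 w, AnalyticAt ℂ u₀ (initialPoint p y₀ w') ∧
      deriv (initialValue p u₀ y₀) w' ≠ 0 :=
  ((hasDerivAt_initialPoint p y₀ w).continuousAt.eventually hu₀.eventually_analyticAt).and
    ((analyticAt_initialValue hu₀).deriv.continuousAt.eventually_ne hne)

theorem eventually_deriv_envelopeTime_ne_zero (hu₀ : AnalyticAt ℂ u₀ (initialPoint p y₀ w))
    (hne : deriv (initialValue p u₀ y₀) w ≠ 0)
    (hiso : ∀ᶠ c in 𝓝[≠] initialValue p u₀ y₀ w, implicitEq p u₀ (envelope p u₀ y₀ w) c ≠ 0) :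
    ∀ᶠ w' in 𝓝[≠] w, deriv (envelopeTime p u₀ y₀) w' ≠ 0 := by
  refine (analyticAt_envelopeTime hu₀ hne).deriv.eventually_eq_zero_or_eventually_ne_zero
    |>.resolve_left fun hzero => ?_
  -- Otherwise the envelope is a point, and all values on the curve are zeros at that point.
  have hregular := eventually_regular_initialValue hu₀ hne
  have hconst : ∀ᶠ w' in 𝓝 w, envelope p u₀ y₀ w' = envelope p u₀ y₀ w := by
    obtain ⟨ε, hε, hball⟩ := Metric.eventually_nhds_iff_ball.1 (hregular.and hzero)
    have hderiv {w' : ℂ} (hw' : w' ∈ Metric.ball w ε) : HasDerivAt (envelope p u₀ y₀) 0 w' := by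
      simpa only [(hball w' hw').2, zero_smul] using
        hasDerivAt_envelope (hball w' hw').1.1 (hball w' hw').1.2
    filter_upwards [Metric.ball_mem_nhds w hε] with w' hw'
    exact Metric.isOpen_ball.is_const_of_deriv_eq_zero (convex_ball w ε).isPreconnected
      (fun s hs => (hderiv hs).differentiableAt.differentiableWithinAt)
      (fun s hs => (hderiv hs).deriv) hw' (Metric.mem_ball_self hε)
  have hvalue : Tendsto (initialValue p u₀ y₀) (𝓝[≠] w) (𝓝[≠] initialValue p u₀ y₀ w) :=
    (analyticAt_initialValue hu₀).differentiableAt.hasDerivAt.tendsto_nhdsNE hne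
  obtain ⟨w', hw', hconst', hregular'⟩ := ((hvalue.eventually hiso).and
    ((hconst.and hregular).filter_mono nhdsWithin_le_nhds)).exists
  rw [← hconst'] at hw'
  exact hw' (isDoubleZero_envelope hregular'.1.differentiableAt hregular'.2).1

theorem IsDoubleZero.transport_eq_zero {q : SpaceTime n} {c : ℂ} (hqc : IsDoubleZero p u₀ q c)
    (hu₀ : AnalyticAt ℂ u₀ (foot q c)) (hiso : ∀ᶠ c' in 𝓝[≠] c, implicitEq p u₀ q c' ≠ 0)
    {h : SpaceTime n → ℂ} (hh : AnalyticAt ℂ h q)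
    (hzero : ∀ᶠ w in 𝓝 (q, c), IsDoubleZero p u₀ w.1 w.2 → h w.1 = 0) :
    transport c h q = 0 := by
  obtain ⟨y₀, w₀, hpoint, rfl, rfl, hne⟩ := hqc.exists_eq_envelope hu₀.differentiableAt
  rw [hpoint] at hu₀
  have hregular := eventually_regular_initialValue hu₀ hne
  have hcurve : ContinuousAt (fun w => (envelope p u₀ y₀ w, initialValue p u₀ y₀ w)) w₀ :=
    (hasDerivAt_envelope hu₀ hne).continuousAt.prodMk (analyticAt_initialValue hu₀).continuousAt
  have hvanish : ∀ᶠ w in 𝓝 w₀, h (envelope p u₀ y₀ w) = 0 := by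
    filter_upwards [hcurve.eventually hzero, hregular] with w hw hreg
    exact hw (isDoubleZero_envelope hreg.1.differentiableAt hreg.2)
  have htransport : ∀ᶠ w in 𝓝[≠] w₀,
      transport (initialValue p u₀ y₀ w) h (envelope p u₀ y₀ w) = 0 := by
    filter_upwards [eventually_deriv_envelopeTime_ne_zero hu₀ hne hiso,
      hregular.filter_mono nhdsWithin_le_nhds,
      hvanish.eventually_nhds.filter_mono nhdsWithin_le_nhds,
      (hcurve.fst.eventually hh.eventually_analyticAt).filter_mono nhdsWithin_le_nhds]
      with w htime hreg hvan han
    exact (mul_eq_zero.1 (mul_transport_eq_zero_of_hasDerivAt han.differentiableAt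
      (hasDerivAt_envelope hreg.1 hreg.2) hvan)).resolve_left htime
  have hlim := ((continuousAt_transport hh _).tendsto.comp hcurve.tendsto).mono_left
    (nhdsWithin_le_nhds (s := {w₀}ᶜ))
  exact tendsto_nhds_unique (hlim.congr' htransport) tendsto_const_nhds

end Envelope

section PolynomialReduction

variable {n : ℕ} {u₀ : (Fin n → ℂ) → ℂ}

theorem analyticAt_prodMk_initial_add {w : SpaceTime n × ℂ} (hu₀ : AnalyticAt ℂ u₀ w.1.2) :
    AnalyticAt ℂ (fun w : SpaceTime n × ℂ => (w.1, u₀ w.1.2 + w.2)) w := by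
  have hsnd : AnalyticAt ℂ (fun w : SpaceTime n × ℂ => w.1.2) w :=
    AnalyticAt.fun_comp (g := Prod.snd) analyticAt_snd analyticAt_fst
  have hcomp := AnalyticAt.fun_comp (g := u₀) (f := fun w : SpaceTime n × ℂ => w.1.2) hu₀ hsnd
  exact analyticAt_fst.prod (hcomp.add analyticAt_snd)

theorem exists_eventually_analyticAt_foot (hu₀ : AnalyticAt ℂ u₀ 0) :
    ∃ δ > 0, ∀ᶠ q in 𝓝 (0 : SpaceTime n), ∀ z ∈ Metric.ball (0 : ℂ) δ,
      AnalyticAt ℂ u₀ (foot q (u₀ q.2 + z)) := by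
  have hcont : ContinuousAt (fun w : SpaceTime n × ℂ => foot w.1 (u₀ w.1.2 + w.2)) (0, 0) :=
    ContinuousAt.comp (g := fun w : SpaceTime n × ℂ => foot w.1 w.2)
      (f := fun w : SpaceTime n × ℂ => (w.1, u₀ w.1.2 + w.2)) (analyticAt_foot _).continuousAt
      (analyticAt_prodMk_initial_add hu₀).continuousAt
  have hfoot : ∀ᶠ w in 𝓝 ((0 : SpaceTime n), (0 : ℂ)),
      AnalyticAt ℂ u₀ (foot w.1 (u₀ w.1.2 + w.2)) :=
    hcont.eventually (by simpa [foot] using hu₀.eventually_analyticAt)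
  rw [nhds_prod_eq] at hfoot
  obtain ⟨P, hP, P', hP', hPP'⟩ := eventually_prod_iff.1 hfoot
  obtain ⟨δ, hδ, hball⟩ := Metric.eventually_nhds_iff_ball.1 hP'
  exact ⟨δ, hδ, hP.mono fun q hq z hz => hPP' hq (hball z hz)⟩

variable [NeZero n] {p : ℕ}

theorem implicitEq_initial_add {q : SpaceTime n} (hq : q.1 = 0) (z : ℂ) :
    implicitEq p u₀ q (u₀ q.2 + z) = z ^ p - q.2 0 := by
  rw [implicitEq, foot_of_fst_eq_zero hq, add_sub_cancel_left]

/-- On `U`, the values in a disc around `u₀ x` of the solution of the implicit equation are the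
sums `u₀ x + z`, `z` a root of the monic polynomial with coefficients `A (t, x)`. -/
structure PolynomialReduction (p : ℕ) [NeZero p] (u₀ : (Fin n → ℂ) → ℂ) (U : Set (SpaceTime n))
    (A : SpaceTime n → Fin p → ℂ) (δ : ℝ) : Prop where
  isOpen : IsOpen U
  analyticAt_coeff : ∀ q ∈ U, AnalyticAt ℂ A q
  analyticAt_initial : ∀ q ∈ U, AnalyticAt ℂ u₀ q.2
  coeff_eq_single : ∀ q ∈ U, q.1 = 0 → A q = Pi.single 0 (q.2 0)
  mem_ball_of_root : ∀ q ∈ U, ∀ z, (weierstrassPoly (A q)).eval z = 0 → z ∈ Metric.ball 0 δ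
  analyticAt_foot : ∀ q ∈ U, ∀ z ∈ Metric.ball (0 : ℂ) δ, AnalyticAt ℂ u₀ (foot q (u₀ q.2 + z))
  exists_factorization : ∀ q ∈ U, ∃ R : ℂ → ℂ, DifferentiableOn ℂ R (Metric.ball 0 δ) ∧
    ∀ z ∈ Metric.ball 0 δ, R z ≠ 0 ∧
      implicitEq p u₀ q (u₀ q.2 + z) = (weierstrassPoly (A q)).eval z * R z

theorem exists_polynomialReduction [NeZero p] (hu₀ : AnalyticAt ℂ u₀ 0) :
    ∃ (U : Set (SpaceTime n)) (A : SpaceTime n → Fin p → ℂ) (δ : ℝ), 0 ∈ U ∧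
      PolynomialReduction p u₀ U A δ := by
  let f : SpaceTime n × ℂ → ℂ := fun w => implicitEq p u₀ w.1 (u₀ w.1.2 + w.2)
  have hf : AnalyticAt ℂ f (0, 0) :=
    AnalyticAt.fun_comp (g := fun w : SpaceTime n × ℂ => implicitEq p u₀ w.1 w.2)
      (f := fun w : SpaceTime n × ℂ => (w.1, u₀ w.1.2 + w.2))
      (analyticAt_implicitEq (by simpa [foot] using hu₀)) (analyticAt_prodMk_initial_add hu₀)
  have hord : analyticOrderAt (fun z => f (0, z)) 0 = p := by
    have hpow : (fun z => f (0, z)) = (fun z => z - 0) ^ p := by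
      ext z
      simp [f, implicitEq_initial_add]
    rw [hpow, analyticOrderAt_centeredMonomial]
  obtain ⟨A, hA, hA0, δ, hδ, hfactor⟩ := exists_weierstrass_preparation hf hord
  obtain ⟨δ', hδ', hfoot⟩ := exists_eventually_analyticAt_foot hu₀
  have hroot : ∀ᶠ q in 𝓝 0, ∀ z, (weierstrassPoly (A q)).eval z = 0 → ‖z‖ < min δ δ' :=
    (hA0 ▸ hA.continuousAt.tendsto).eventually (eventually_norm_root_lt (lt_min hδ hδ'))
  have hinitial : ∀ᶠ q : SpaceTime n in 𝓝 0, AnalyticAt ℂ u₀ q.2 :=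
    continuousAt_snd.eventually hu₀.eventually_analyticAt
  obtain ⟨U, hU, hUo, h0U⟩ := eventually_nhds_iff.1
    (hA.eventually_analyticAt.and (hinitial.and (hroot.and (hfoot.and hfactor))))
  refine ⟨U, A, min δ δ', h0U, hUo, fun q hq => (hU q hq).1, fun q hq => (hU q hq).2.1,
    fun q hq hq0 => ?_, fun q hq z hz => mem_ball_zero_iff.2 ((hU q hq).2.2.1 z hz),
    fun q hq z hz => (hU q hq).2.2.2.1 z (Metric.ball_subset_ball (min_le_right _ _) hz),
    fun q hq => ?_⟩
  all_goals
    obtain ⟨-, -, hroot, -, R, hR, hfactor⟩ := hU q hq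
  · refine weierstrassPoly_unique Metric.isOpen_ball hR.continuousOn
      (fun z hz => mem_ball_zero_iff.2 ((hroot z hz).trans_le (min_le_left _ _))) fun z hz => ?_
    rw [← (hfactor z hz).2, weierstrassPoly_single_zero]
    simp [f, implicitEq_initial_add hq0]
  · have hsub := Metric.ball_subset_ball (x := (0 : ℂ)) (min_le_left δ δ')
    exact ⟨R, hR.mono hsub, fun z hz => hfactor z (hsub hz)⟩

namespace PolynomialReduction

variable [NeZero p] {U : Set (SpaceTime n)} {A : SpaceTime n → Fin p → ℂ} {δ : ℝ} {q : SpaceTime n}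
  {z : ℂ}

theorem implicitEq_eq_zero_iff (hred : PolynomialReduction p u₀ U A δ) (hq : q ∈ U)
    (hz : z ∈ Metric.ball 0 δ) :
    implicitEq p u₀ q (u₀ q.2 + z) = 0 ↔ (weierstrassPoly (A q)).eval z = 0 := by
  obtain ⟨R, -, hR⟩ := hred.exists_factorization q hq
  rw [(hR z hz).2, mul_eq_zero, or_iff_left (hR z hz).1]

theorem implicitEq_eq_zero_of_root (hred : PolynomialReduction p u₀ U A δ) (hq : q ∈ U)
    (hz : (weierstrassPoly (A q)).eval z = 0) : implicitEq p u₀ q (u₀ q.2 + z) = 0 :=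
  (hred.implicitEq_eq_zero_iff hq (hred.mem_ball_of_root q hq z hz)).2 hz

theorem deriv_implicitEq_eq_zero_iff (hred : PolynomialReduction p u₀ U A δ) (hq : q ∈ U)
    (hz : (weierstrassPoly (A q)).eval z = 0) :
    deriv (implicitEq p u₀ q) (u₀ q.2 + z) = 0 ↔
      (Polynomial.derivative (weierstrassPoly (A q))).eval z = 0 := by
  obtain ⟨R, hR, hfactor⟩ := hred.exists_factorization q hq
  have hball : Metric.ball 0 δ ∈ 𝓝 z :=
    Metric.isOpen_ball.mem_nhds (hred.mem_ball_of_root q hq z hz)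
  have hlocal : (fun y => implicitEq p u₀ q (u₀ q.2 + y)) =ᶠ[𝓝 z]
      fun y => (weierstrassPoly (A q)).eval y * R y := by
    filter_upwards [hball] with y hy using (hfactor y hy).2
  rw [← deriv_comp_const_add, hlocal.deriv_eq, (((weierstrassPoly (A q)).hasDerivAt z).fun_mul
    (hR.differentiableAt hball).hasDerivAt).deriv, hz, zero_mul, add_zero, mul_eq_zero,
    or_iff_left (hfactor z (mem_of_mem_nhds hball)).1]

theorem isDoubleZero_iff (hred : PolynomialReduction p u₀ U A δ) (hq : q ∈ U)
    (hz : z ∈ Metric.ball 0 δ) :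
    IsDoubleZero p u₀ q (u₀ q.2 + z) ↔ IsMultipleRootAt (fun j q => A q j) q z := by
  rw [IsDoubleZero, isMultipleRootAt_iff, hred.implicitEq_eq_zero_iff hq hz]
  exact and_congr_right fun hroot => hred.deriv_implicitEq_eq_zero_iff hq hroot

theorem analyticOnNhd_initial (hred : PolynomialReduction p u₀ U A δ) :
    AnalyticOnNhd ℂ (fun q : SpaceTime n => u₀ q.2) U :=
  fun q hq => AnalyticAt.fun_comp (hred.analyticAt_initial q hq) analyticAt_snd

theorem analyticOnNhd_weierstrassDisc (hred : PolynomialReduction p u₀ U A δ) :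
    AnalyticOnNhd ℂ (fun q => weierstrassDisc (A q)) U :=
  fun q hq => AnalyticAt.fun_comp (analyticAt_weierstrassDisc _) (hred.analyticAt_coeff q hq)

theorem eventually_implicitEq_ne_zero (hred : PolynomialReduction p u₀ U A δ) (hq : q ∈ U)
    (hz : z ∈ Metric.ball 0 δ) : ∀ᶠ c in 𝓝[≠] (u₀ q.2 + z), implicitEq p u₀ q c ≠ 0 := by
  have hroots : {c | (weierstrassPoly (A q)).IsRoot (c - u₀ q.2)}.Finite :=
    (Polynomial.finite_setOfPred_isRoot (monic_weierstrassPoly (A q)).ne_zero).preimage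
      (sub_left_injective.injOn)
  have hball : ∀ᶠ c in 𝓝 (u₀ q.2 + z), c - u₀ q.2 ∈ Metric.ball 0 δ :=
    (continuousAt_id.sub continuousAt_const).eventually
      (Metric.isOpen_ball.mem_nhds (by simpa using hz))
  filter_upwards [nhdsNE_of_nhdsNE_sdiff_finite univ_mem hroots.to_subtype,
    hball.filter_mono nhdsWithin_le_nhds] with c hc hcball hzero
  rw [← add_sub_cancel (u₀ q.2) c, hred.implicitEq_eq_zero_iff hq hcball] at hzero
  exact hc.2 hzero

theorem isCharacteristic (hred : PolynomialReduction p u₀ U A δ) :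
    IsCharacteristic (fun q => u₀ q.2) (fun j q => A q j) {q ∈ U | weierstrassDisc (A q) = 0} := by
  rintro q ⟨hq, -⟩ ζ hζ h hh hvanish
  have hball := hred.mem_ball_of_root q hq ζ (isMultipleRootAt_iff.1 hζ).1
  refine ((hred.isDoubleZero_iff hq hball).2 hζ).transport_eq_zero
    (hred.analyticAt_foot q hq ζ hball) (hred.eventually_implicitEq_ne_zero hq hball) hh ?_
  have hroot : ContinuousAt (fun w : SpaceTime n × ℂ => w.2 - u₀ w.1.2) (q, u₀ q.2 + ζ) :=
    continuousAt_snd.sub (ContinuousAt.comp (g := fun q : SpaceTime n => u₀ q.2)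
      (hred.analyticOnNhd_initial q hq).continuousAt continuousAt_fst)
  have hroot_ball : ∀ᶠ w in 𝓝 (q, u₀ q.2 + ζ), w.2 - u₀ w.1.2 ∈ Metric.ball 0 δ :=
    hroot.eventually (Metric.isOpen_ball.mem_nhds (by simpa only [add_sub_cancel_left] using hball))
  filter_upwards [hroot_ball, continuousAt_fst.eventually (hred.isOpen.mem_nhds hq),
    continuousAt_fst.eventually hvanish] with w hw hwU hwh hdouble
  rw [← add_sub_cancel (u₀ w.1.2) w.2, hred.isDoubleZero_iff hwU hw] at hdouble
  exact hwh ⟨hwU, weierstrassDisc_eq_zero_iff_exists_isMultipleRootAt.2 ⟨_, hdouble⟩⟩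

theorem burgers_eq_zero (hred : PolynomialReduction p u₀ U A δ) (hq : q ∈ U)
    (hdisc : weierstrassDisc (A q) ≠ 0) {f : SpaceTime n → ℂ}
    (hf : IsAlgebraicGerm (fun j q => A q j) q f) : burgers (fun q => u₀ q.2 + f q) q = 0 := by
  obtain ⟨hfan, hroot⟩ := isAlgebraicGerm_iff.1 hf
  have hroot_q := hroot.self_of_nhds
  refine burgers_eq_zero_of_implicitEq (p := p)
    ((hred.analyticOnNhd_initial q hq).add hfan).differentiableAt
    (hred.analyticAt_foot q hq _ (hred.mem_ball_of_root q hq _ hroot_q)) ?_ fun hderiv => hdisc ?_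
  · filter_upwards [hroot, hred.isOpen.mem_nhds hq] with q' hq'root hq'
    exact hred.implicitEq_eq_zero_of_root hq' hq'root
  · exact (weierstrassDisc_eq_zero_iff _).2
      ⟨f q, hroot_q, (hred.deriv_implicitEq_eq_zero_iff hq hroot_q).1 hderiv⟩

section InitialValueProblem

variable {x₀ : Fin n → ℂ} {r : (Fin n → ℂ) → ℂ}

theorem eval_rootBranch (hred : PolynomialReduction p u₀ U A δ) (hr : IsRootBranch p r x₀)
    (hx₀ : (0, x₀) ∈ U) : ∀ᶠ x in 𝓝 x₀, (weierstrassPoly (A (0, x))).eval (r x) = 0 := by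
  filter_upwards [hr.2, (Continuous.prodMk_right 0).continuousAt.eventually
    (hred.isOpen.mem_nhds hx₀)] with x hx hxU
  rw [hred.coeff_eq_single _ hxU rfl, weierstrassPoly_single_zero]
  simp [hx]

theorem exists_isSolutionGerm (hred : PolynomialReduction p u₀ U A δ) (hr : IsRootBranch p r x₀)
    (hx₀ : (0, x₀) ∈ U) (hdisc : weierstrassDisc (A (0, x₀)) ≠ 0) :
    ∃ z, IsAlgebraicGerm (fun j q => A q j) (0, x₀) z ∧ (∀ᶠ x in 𝓝 x₀, z (0, x) = r x) ∧
      IsSolutionGerm u₀ r x₀ (fun q => u₀ q.2 + z q) := by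
  have hroot := hred.eval_rootBranch hr hx₀
  obtain ⟨z, hzan, -, hzroot, hzunique⟩ := exists_analyticAt_root (hred.analyticAt_coeff _ hx₀)
    hroot.self_of_nhds fun h => hdisc ((weierstrassDisc_eq_zero_iff _).2
      ⟨_, hroot.self_of_nhds, h⟩)
  have hz : IsAlgebraicGerm (fun j q => A q j) (0, x₀) z := isAlgebraicGerm_iff.2 ⟨hzan, hzroot⟩
  have hzr : ∀ᶠ x in 𝓝 x₀, z (0, x) = r x := by
    have hgraph : ContinuousAt (fun x => (((0, x) : SpaceTime n), r x)) x₀ :=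
      (Continuous.prodMk_right 0).continuousAt.prodMk hr.1.continuousAt
    filter_upwards [hgraph.eventually hzunique, hroot] with x hx hxroot
    exact (hx hxroot).symm
  refine ⟨z, hz, hzr, (hred.analyticOnNhd_initial _ hx₀).add hzan, ?_, ?_⟩
  · filter_upwards [hred.isOpen.mem_nhds hx₀, hzan.eventually_analyticAt, hz.2.eventually_nhds,
      (hred.analyticOnNhd_weierstrassDisc _ hx₀).continuousAt.eventually_ne hdisc]
      with q hq hqan hqroot hqdisc
    exact hred.burgers_eq_zero hq hqdisc ⟨hqan, hqroot⟩
  · filter_upwards [hzr] with x hx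
    rw [hx]

theorem isAlgebraicGerm_sub_initial (hred : PolynomialReduction p u₀ U A δ)
    (hr : IsRootBranch p r x₀) (hx₀ : (0, x₀) ∈ U) {w : SpaceTime n → ℂ}
    (hw : IsSolutionGerm u₀ r x₀ w) :
    IsAlgebraicGerm (fun j q => A q j) (0, x₀) (fun q => w q - u₀ q.2) := by
  have han : AnalyticAt ℂ (fun q => w q - u₀ q.2) (0, x₀) :=
    hw.1.sub (hred.analyticOnNhd_initial _ hx₀)
  have hball : w (0, x₀) - u₀ x₀ ∈ Metric.ball 0 δ := by
    rw [hw.2.2.self_of_nhds, add_sub_cancel_left]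
    exact hred.mem_ball_of_root _ hx₀ _ (hred.eval_rootBranch hr hx₀).self_of_nhds
  refine isAlgebraicGerm_iff.2 ⟨han, ?_⟩
  filter_upwards [eventually_implicitEq_of_isSolutionGerm hr hw, hred.isOpen.mem_nhds hx₀,
    han.continuousAt.eventually (Metric.isOpen_ball.mem_nhds hball)] with q hq hqU hqball
  rwa [← hred.implicitEq_eq_zero_iff hqU hqball, add_sub_cancel]

theorem eventuallyEq_of_isSolutionGerm (hred : PolynomialReduction p u₀ U A δ)
    (hr : IsRootBranch p r x₀) (hx₀ : (0, x₀) ∈ U) (hdisc : weierstrassDisc (A (0, x₀)) ≠ 0)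
    {w w' : SpaceTime n → ℂ} (hw : IsSolutionGerm u₀ r x₀ w) (hw' : IsSolutionGerm u₀ r x₀ w') :
    w =ᶠ[𝓝 (0, x₀)] w' := by
  have heq := (hred.isAlgebraicGerm_sub_initial hr hx₀ hw).eventuallyEq
    (hred.analyticAt_coeff _ hx₀) hdisc (hred.isAlgebraicGerm_sub_initial hr hx₀ hw')
    (by simp only [hw.2.2.self_of_nhds, hw'.2.2.self_of_nhds])
  filter_upwards [heq] with q hq using sub_left_injective hq

end InitialValueProblem

end PolynomialReduction

end PolynomialReduction

end RamifiedBurgers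

open RamifiedBurgers

theorem mainTheorem2 (n p : ℕ) [NeZero n] [NeZero p]
    (u₀ : (Fin n → ℂ) → ℂ) (hu₀ : AnalyticAt ℂ u₀ 0) :
    ∃ (U : Set (RamifiedBurgers.SpaceTime n)) (v : RamifiedBurgers.SpaceTime n → ℂ)
      (a : Fin p → RamifiedBurgers.SpaceTime n → ℂ) (D : RamifiedBurgers.SpaceTime n → ℂ),
      -- holomorphic data near the origin
      IsOpen U ∧ (0 : RamifiedBurgers.SpaceTime n) ∈ U ∧
      AnalyticOnNhd ℂ v U ∧ (∀ j, AnalyticOnNhd ℂ (a j) U) ∧ AnalyticOnNhd ℂ D U ∧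
      -- initial conditions
      (∀ x, ((0, x) : RamifiedBurgers.SpaceTime n) ∈ U →
        v (0, x) = u₀ x ∧ a 0 (0, x) = x 0 ∧ ∀ j, j ≠ 0 → a j (0, x) = 0) ∧
      -- the branch locus `D = 0`: a characteristic hypersurface that restricts to `x₁ = 0`
      (∀ q ∈ U, D q = 0 ↔ ∃ ζ, RamifiedBurgers.IsMultipleRootAt a q ζ) ∧
      (∀ x, ((0, x) : RamifiedBurgers.SpaceTime n) ∈ U → (D (0, x) = 0 ↔ p ≠ 1 ∧ x 0 = 0)) ∧
      RamifiedBurgers.IsCharacteristic v a {q ∈ U | D q = 0} ∧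
      -- every branch of `v + z` off the branch locus solves the equation
      (∀ q ∈ U, D q ≠ 0 → ∀ z, RamifiedBurgers.IsAlgebraicGerm a q z →
        RamifiedBurgers.burgers (fun q' => v q' + z q') q = 0) ∧
      -- for every choice of base point and of branch of the datum, the initial value problem has
      -- a solution `v + z`; it is unique, and continues along all paths off the branch locus
      (∀ x₀, ((0, x₀) : RamifiedBurgers.SpaceTime n) ∈ U → D (0, x₀) ≠ 0 →
        ∀ r, RamifiedBurgers.IsRootBranch p r x₀ →
          ∃ z, RamifiedBurgers.IsAlgebraicGerm a (0, x₀) z ∧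
            (∀ᶠ x in nhds x₀, z (0, x) = r x) ∧
            RamifiedBurgers.IsSolutionGerm u₀ r x₀ (fun q => v q + z q) ∧
            (∀ w, RamifiedBurgers.IsSolutionGerm u₀ r x₀ w →
              w =ᶠ[nhds (0, x₀)] fun q => v q + z q) ∧
            ∀ γ : C(unitInterval, RamifiedBurgers.SpaceTime n), γ 0 = (0, x₀) →
              (∀ τ, γ τ ∈ U ∧ D (γ τ) ≠ 0) →
              RamifiedBurgers.ContinuesAlong (fun q => v q + z q) γ) := by
  obtain ⟨U, A, δ, h0U, hred⟩ := exists_polynomialReduction (p := p) hu₀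
  refine ⟨U, fun q => u₀ q.2, fun j q => A q j, fun q => weierstrassDisc (A q), hred.isOpen, h0U,
    hred.analyticOnNhd_initial, fun j q hq => analyticAt_pi_iff.1 (hred.analyticAt_coeff q hq) j,
    hred.analyticOnNhd_weierstrassDisc, fun x hx => ?initial,
    fun q _ => weierstrassDisc_eq_zero_iff_exists_isMultipleRootAt, fun x hx => ?disc,
    hred.isCharacteristic, fun q hq hdisc z hz => hred.burgers_eq_zero hq hdisc hz,
    fun x₀ hx₀ hdisc r hr => ?cauchy⟩
  case initial =>
    simp only [hred.coeff_eq_single _ hx rfl]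
    exact ⟨trivial, Pi.single_eq_same _ _, fun j hj => Pi.single_eq_of_ne hj _⟩
  case disc =>
    simp only [hred.coeff_eq_single _ hx rfl]
    exact weierstrassDisc_single_eq_zero_iff _
  case cauchy =>
    obtain ⟨z, hz, hzr, hsol⟩ := hred.exists_isSolutionGerm hr hx₀ hdisc
    exact ⟨z, hz, hzr, hsol, fun w hw => hred.eventuallyEq_of_isSolutionGerm hr hx₀ hdisc hw hsol,
      fun γ hγ hγU => continuesAlong_add_root
        (fun τ => hred.analyticOnNhd_initial _ (hγU τ).1)
        (fun τ => hred.analyticAt_coeff _ (hγU τ).1) (fun τ => (hγU τ).2) (hγ ▸ hz)⟩
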